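/- Let $q\in(0,1)$. Let $U_q\mathfrak{sl}_2$ be the complex algebra with generators $K,K^{-1},E,F$ and relations $KK^{-1}=K^{-1}K=1$, $K^{\pm1}E=q^{\pm2}EK^{\pm1}$, $K^{\pm1}F=q^{\mp2}FK^{\pm1}$, $EF-FE=(K-K^{-1})/(q-q^{-1})$, with the coproduct $\Delta(K^{\pm1})=K^{\pm1}\otimes K^{\pm1}$, $\Delta(E)=E\otimes1+K\otimes E$, $\Delta(F)=F\otimes K^{-1}+1\otimes F$ and the counit $\varepsilon(E)=\varepsilon(F)=0$, $\varepsilon(K^{\pm1})=1$; let $U_q\mathfrak b_+$ be its subalgebra generated by $K,K^{-1},E$. An invariant integral on a $U_q\mathfrak{sl}_2$-module $V$ is a linear functional $\eta:V\to\mathbb C$ with $\eta(av)=\varepsilon(a)\eta(v)$ for all $a\in U_q\mathfrak{sl}_2$, $v\in V$. Let $\mathrm{Pol}(\mathbb C)_q$ be the unital complex algebra generated by $z,z^*$ with the relation $z^*z=q^2zz^*+1-q^2$; the monomials $z^jz^{*k}$ form a basis of it. It is a covariant algebra ($a\cdot1=\varepsilon(a)1$, and the multiplication is a morphism of $U_q\mathfrak{sl}_2$-modules)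 for the action determined by $$K^{\pm1}z=q^{\pm2}z,\quad Ez=-q^{1/2}z^2,\quad Fz=q^{1/2},\qquad K^{\pm1}z^*=q^{\mp2}z^*,\quad Ez^*=q^{-3/2},\quad Fz^*=-q^{5/2}z^{*2}.$$ Let $D(U)_q'$ be the space of formal series $f=\sum_{j,k\ge0}a_{jk}z^jz^{*k}$ with the topology of coefficientwise convergence. The $\mathrm{Pol}(\mathbb C)_q$-bimodule structure and the $U_q\mathfrak{sl}_2$-action extend to $D(U)_q'$ by continuity. The space of finite functions in the quantum disc is $$D(U)_q=\{f\in D(U)_q'\;:\;z^{*N}f=fz^N=0\text{ for some }N\in\mathbb N\}.$$ It is a $U_q\mathfrak{sl}_2$-submodule, and an algebra with the product $fg=\sum_{j,k}a_{jk}z^j(z^{*k}g)$ for $f=\sum a_{jk}z^jz^{*k}$. Let $\widetilde H=\{f\in D(U)_q: fz=0\}$; it is stable under $U_q\mathfrak b_+$ and under left multiplication by $D(U)_q$. Denote by $\widetilde\Gamma$ and $\widetilde T$ the resulting representations of $U_q\mathfrak b_+$ and $D(U)_q$ in $\widetilde H$. **Theorem.** (1) For every $f\in D(U)_q$ the operator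 $\widetilde T(f)\widetilde\Gamma(K^{-1})$ on $\widetilde H$ has finite rank, and $$\eta(f)=\mathrm{tr}\bigl(\widetilde T(f)\widetilde\Gamma(K^{-1})\bigr)$$ is an invariant integral on $D(U)_q$. (2) Put $y=1-zz^*$. For a function $\psi$ on $\{q^{2n}:n\ge0\}$ let $\psi(y)\in D(U)_q'$ be the unique series $\sum_k c_kz^kz^{*k}$ such that $\sum_{k} c_k\prod_{i<k}(1-q^{-2i}q^{2n})=\psi(q^{2n})$ for all $n\ge0$ (note that $z^kz^{*k}=\prod_{i<k}(1-q^{-2i}y)$, and that the terms with $k>n$ vanish). Every $f\in D(U)_q$ has a unique decomposition $$f=\sum_{j>0}z^j\psi_j(y)+\psi_0(y)+\sum_{j>0}\psi_{-j}(y)z^{*j}$$ with functions $\psi_j$ on $\{q^{2n}:n\ge0\}$, $j\in\mathbb Z$, that have only finitely many nonzero values in total. The linear functional $$\int_{U_q}f\,d\nu=(1-q^2)\sum_{n=0}^\infty\psi_0(q^{2n})q^{-2n}$$ is a nonzero scalar multiple of $\eta$, and hence is an invariant integral on $D(U)_q$. -/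

import Mathlib

noncomputable section

namespace QDisc

/-- The deformation parameter `q ∈ (0,1)`, regarded as a complex number. -/
abbrev qc (q : Set.Ioo (0 : ℝ) 1) : ℂ := ((q : ℝ) : ℂ)

/-- The positive square root `q^{1/2}`, regarded as a complex number. -/
abbrev qh (q : Set.Ioo (0 : ℝ) 1) : ℂ := ((Real.sqrt (q : ℝ) : ℝ) : ℂ)

theorem qc_ne (q : Set.Ioo (0 : ℝ) 1) : qc q ≠ 0 := by
  simpa using q.2.1.ne'

theorem qh_sq (q : Set.Ioo (0 : ℝ) 1) : qh q ^ 2 = qc q := by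
  have := Real.sq_sqrt q.2.1.le
  simp only [qh, qc]
  exact_mod_cast this

theorem qh_ne (q : Set.Ioo (0 : ℝ) 1) : qh q ≠ 0 := by
  intro h
  have := qh_sq q
  rw [h] at this
  exact qc_ne q (by simpa using this.symm)

theorem qc_pow_ne_one (q : Set.Ioo (0 : ℝ) 1) {n : ℕ} (hn : n ≠ 0) : qc q ^ n ≠ 1 := by
  have := pow_lt_one₀ q.2.1.le q.2.2 hn
  simp only [qc]
  exact_mod_cast this.ne

/-! ### The quantum universal enveloping algebra -/

/-- Names of the generators `K`, `K⁻¹`, `E`, `F`. -/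
inductive UqGen
  | K
  | Kinv
  | E
  | F

open FreeAlgebra in
/-- The defining relations of `U_q sl₂`. -/
inductive UqRel (q : Set.Ioo (0 : ℝ) 1) : FreeAlgebra ℂ UqGen → FreeAlgebra ℂ UqGen → Prop
  | K_Kinv : UqRel q (ι ℂ UqGen.K * ι ℂ UqGen.Kinv) 1
  | Kinv_K : UqRel q (ι ℂ UqGen.Kinv * ι ℂ UqGen.K) 1
  | K_E : UqRel q (ι ℂ UqGen.K * ι ℂ UqGen.E) (qc q ^ 2 • (ι ℂ UqGen.E * ι ℂ UqGen.K))
  | Kinv_E : UqRel q (ι ℂ UqGen.Kinv * ι ℂ UqGen.E)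
      ((qc q ^ 2)⁻¹ • (ι ℂ UqGen.E * ι ℂ UqGen.Kinv))
  | K_F : UqRel q (ι ℂ UqGen.K * ι ℂ UqGen.F) ((qc q ^ 2)⁻¹ • (ι ℂ UqGen.F * ι ℂ UqGen.K))
  | Kinv_F : UqRel q (ι ℂ UqGen.Kinv * ι ℂ UqGen.F)
      (qc q ^ 2 • (ι ℂ UqGen.F * ι ℂ UqGen.Kinv))
  | E_F : UqRel q (ι ℂ UqGen.E * ι ℂ UqGen.F - ι ℂ UqGen.F * ι ℂ UqGen.E)
      ((qc q - (qc q)⁻¹)⁻¹ • (ι ℂ UqGen.K - ι ℂ UqGen.Kinv))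

/-- The complex algebra `U_q sl₂`, by generators and relations. -/
abbrev UqSl2 (q : Set.Ioo (0 : ℝ) 1) : Type := RingQuot (UqRel q)

/-- The generators as elements of `U_q sl₂`. -/
def gen (q : Set.Ioo (0 : ℝ) 1) (g : UqGen) : UqSl2 q :=
  RingQuot.mkAlgHom ℂ (UqRel q) (FreeAlgebra.ι ℂ g)

/-- The counit `ε` of `U_q sl₂`: `ε(E) = ε(F) = 0`, `ε(K^{±1}) = 1`. -/
def counit (q : Set.Ioo (0 : ℝ) 1) : UqSl2 q →ₐ[ℂ] ℂ :=
  RingQuot.liftAlgHom ℂ ⟨FreeAlgebra.lift ℂ (fun g => match g with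
    | UqGen.K => (1 : ℂ)
    | UqGen.Kinv => 1
    | UqGen.E => 0
    | UqGen.F => 0), by
      intro x y h
      cases h <;> simp⟩

/-- The subalgebra `U_q b₊` generated by `K`, `K⁻¹`, `E`. -/
def UqB (q : Set.Ioo (0 : ℝ) 1) : Subalgebra ℂ (UqSl2 q) :=
  Algebra.adjoin ℂ {gen q UqGen.K, gen q UqGen.Kinv, gen q UqGen.E}

/-- `K⁻¹` as an element of `U_q b₊`. -/
def KinvB (q : Set.Ioo (0 : ℝ) 1) : UqB q :=
  ⟨gen q UqGen.Kinv, Algebra.subset_adjoin (by simp)⟩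

/-- An invariant integral on a `U_q sl₂`-module `V` (given by its representation `ρ`): a morphism
of `U_q sl₂`-modules from `V` to the trivial module `ℂ`, on which `a` acts as `ε(a)`. -/
structure IsInvariantIntegral {q : Set.Ioo (0 : ℝ) 1} {V : Type*} [AddCommGroup V] [Module ℂ V]
    (ρ : UqSl2 q →ₐ[ℂ] Module.End ℂ V) (η : V → ℂ) : Prop where
  linear : IsLinearMap ℂ η
  equivariant : ∀ (a : UqSl2 q) (v : V), η (ρ a v) = counit q a * η v

/-! ### Distributions in the quantum disc -/

/-- The space `D(U)_q'` of formal series `f = ∑ a_{jk} z^j z^{*k}`; `f j k` is `a_{jk}`. -/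
abbrev Series : Type := ℕ → ℕ → ℂ

/-- The monomial `z^j z^{*k}`. -/
def mono (j k : ℕ) : Series := fun m n => if m = j ∧ n = k then 1 else 0

/-- Coefficients shifted in the first index: `∑ a_{jk} z^{j+1} z^{*k}`. -/
def upZ (f : Series) : Series := fun j k => match j with
  | 0 => 0
  | j + 1 => f j k

/-- Coefficients shifted in the second index: `∑ a_{jk} z^j z^{*(k+1)}`. -/
def upS (f : Series) : Series := fun j k => match k with
  | 0 => 0
  | k + 1 => f j k

@[simp] theorem upZ_zero (f : Series) (k : ℕ) : upZ f 0 k = 0 := rfl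
@[simp] theorem upZ_succ (f : Series) (j k : ℕ) : upZ f (j + 1) k = f j k := rfl
@[simp] theorem upS_zero (f : Series) (j : ℕ) : upS f j 0 = 0 := by cases j <;> rfl
@[simp] theorem upS_succ (f : Series) (j k : ℕ) : upS f j (k + 1) = f j k := by cases j <;> rfl

/-- The left multiplication `f ↦ z f`. -/
def zL : Module.End ℂ Series where
  toFun f := upZ f
  map_add' f g := by ext j k; cases j <;> simp
  map_smul' c f := by ext j k; cases j <;> simp

/-- The right multiplication `f ↦ f z^*`. -/
def sR : Module.End ℂ Series where
  toFun f := upS f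
  map_add' f g := by ext j k; cases k <;> simp
  map_smul' c f := by ext j k; cases k <;> simp

/-- The left multiplication `f ↦ z^* f`. By `z^* z = q² z z^* + 1 - q²` one has
`z^* z^j = q^{2j} z^j z^* + (1 - q^{2j}) z^{j-1}`. -/
def sL (q : Set.Ioo (0 : ℝ) 1) : Module.End ℂ Series where
  toFun f := fun j k => qc q ^ (2 * j) * upS f j k + (1 - qc q ^ (2 * (j + 1))) * f (j + 1) k
  map_add' f g := by ext j k; cases k <;> simp <;> ring
  map_smul' c f := by ext j k; cases k <;> simp <;> ring

/-- The right multiplication `f ↦ f z`. By `z^* z = q² z z^* + 1 - q²` one has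
`z^{*k} z = q^{2k} z z^{*k} + (1 - q^{2k}) z^{*(k-1)}`. -/
def zR (q : Set.Ioo (0 : ℝ) 1) : Module.End ℂ Series where
  toFun f := fun j k => qc q ^ (2 * k) * upZ f j k + (1 - qc q ^ (2 * (k + 1))) * f j (k + 1)
  map_add' f g := by ext j k; cases j <;> simp <;> ring
  map_smul' c f := by ext j k; cases j <;> simp <;> ring

/-- `z^* (z f) = q² z (z^* f) + (1 - q²) f`. -/
theorem sL_zL (q : Set.Ioo (0 : ℝ) 1) (f : Series) :
    sL q (zL f) = qc q ^ 2 • zL (sL q f) + (1 - qc q ^ 2) • f := by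
  ext j k
  rcases j with _ | j <;> rcases k with _ | k <;> simp [sL, zL] <;> ring

/-- `(f z^*) z = q² (f z) z^* + (1 - q²) f`. -/
theorem zR_sR (q : Set.Ioo (0 : ℝ) 1) (f : Series) :
    zR q (sR f) = qc q ^ 2 • sR (zR q f) + (1 - qc q ^ 2) • f := by
  ext j k
  rcases j with _ | j <;> rcases k with _ | k <;> simp [zR, sR] <;> ring

/-- Left and right multiplications commute: `(z f) z = z (f z)`. -/
theorem zR_zL (q : Set.Ioo (0 : ℝ) 1) (f : Series) : zR q (zL f) = zL (zR q f) := by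
  ext j k
  rcases j with _ | _ | j <;> simp [zR, zL]

/-- Left and right multiplications commute: `(z^* f) z = z^* (f z)`. -/
theorem zR_sL (q : Set.Ioo (0 : ℝ) 1) (f : Series) : zR q (sL q f) = sL q (zR q f) := by
  ext j k
  rcases j with _ | j <;> rcases k with _ | k <;> simp [zR, sL] <;> ring

/-! ### The action of the generators -/

/-- `1 + x + ⋯ + x^{n-1}`. -/
def brk (x : ℂ) (n : ℕ) : ℂ := ∑ i ∈ Finset.range n, x ^ i

@[simp] theorem brk_zero (x : ℂ) : brk x 0 = 0 := by simp [brk]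

theorem brk_succ (x : ℂ) (n : ℕ) : brk x (n + 1) = x * brk x n + 1 := by
  simp [brk, Finset.sum_range_succ', Finset.mul_sum, pow_succ']

theorem one_sub_ne (q : Set.Ioo (0 : ℝ) 1) : 1 - qc q ^ 2 ≠ 0 :=
  sub_ne_zero.2 (qc_pow_ne_one q two_ne_zero).symm

theorem brk_pos (q : Set.Ioo (0 : ℝ) 1) (n : ℕ) :
    brk (qc q ^ 2) n = (1 - qc q ^ (2 * n)) / (1 - qc q ^ 2) := by
  have h := one_sub_ne q
  induction n with
  | zero => simp
  | succ n ih => rw [brk_succ, ih]; field_simp; ring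

theorem brk_neg (q : Set.Ioo (0 : ℝ) 1) (n : ℕ) :
    brk ((qc q)⁻¹ ^ 2) n =
      (1 - qc q ^ (2 * n)) / (1 - qc q ^ 2) * qc q ^ 2 / qc q ^ (2 * n) := by
  have h := one_sub_ne q
  have h0 := qc_ne q
  induction n with
  | zero => simp
  | succ n ih => rw [brk_succ, ih]; field_simp; ring

/-- The action of `K`: `K (z^j z^{*k}) = q^{2j-2k} z^j z^{*k}`. -/
def opK (q : Set.Ioo (0 : ℝ) 1) : Module.End ℂ Series where
  toFun f := fun j k => qc q ^ (2 * j) * ((qc q)⁻¹ ^ (2 * k)) * f j k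
  map_add' f g := by ext j k; simp; ring
  map_smul' c f := by ext j k; simp; ring

/-- The action of `K⁻¹`: `K⁻¹ (z^j z^{*k}) = q^{2k-2j} z^j z^{*k}`. -/
def opKinv (q : Set.Ioo (0 : ℝ) 1) : Module.End ℂ Series where
  toFun f := fun j k => (qc q)⁻¹ ^ (2 * j) * qc q ^ (2 * k) * f j k
  map_add' f g := by ext j k; simp; ring
  map_smul' c f := by ext j k; simp; ring

/-- The action of `E`. By `Δ(E) = E ⊗ 1 + K ⊗ E`, `Ez = -q^{1/2} z²`, `Ez^* = q^{-3/2}` one has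
`E (z^j z^{*k}) = -q^{1/2} (∑_{i<j} q^{2i}) z^{j+1} z^{*k}
  + q^{2j-3/2} (∑_{i<k} q^{-2i}) z^j z^{*(k-1)}`. -/
def opE (q : Set.Ioo (0 : ℝ) 1) : Module.End ℂ Series where
  toFun f := fun j k => -qh q * upZ (fun j k => brk (qc q ^ 2) j * f j k) j k
    + qc q ^ (2 * j) * (qh q ^ 3)⁻¹ * brk ((qc q)⁻¹ ^ 2) (k + 1) * f j (k + 1)
  map_add' f g := by ext j k; cases j <;> simp <;> ring
  map_smul' c f := by ext j k; cases j <;> simp <;> ring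

/-- The action of `F`. By `Δ(F) = F ⊗ K⁻¹ + 1 ⊗ F`, `Fz = q^{1/2}`, `Fz^* = -q^{5/2} z^{*2}` one
has `F (z^j z^{*k}) = q^{1/2+2k} (∑_{i<j} q^{-2i}) z^{j-1} z^{*k}
  - q^{5/2} (∑_{i<k} q^{2i}) z^j z^{*(k+1)}`. -/
def opF (q : Set.Ioo (0 : ℝ) 1) : Module.End ℂ Series where
  toFun f := fun j k => qh q * qc q ^ (2 * k) * brk ((qc q)⁻¹ ^ 2) (j + 1) * f (j + 1) k
    - qh q ^ 5 * upS (fun j k => brk (qc q ^ 2) k * f j k) j k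
  map_add' f g := by ext j k; cases k <;> simp <;> ring
  map_smul' c f := by ext j k; cases k <;> simp <;> ring

/-- The unit is an invariant; with the covariance relations below this determines the action on
polynomials, hence, by continuity, on formal series. -/
theorem op_one (q : Set.Ioo (0 : ℝ) 1) : opK q (mono 0 0) = mono 0 0 ∧
    opKinv q (mono 0 0) = mono 0 0 ∧ opE q (mono 0 0) = 0 ∧ opF q (mono 0 0) = 0 := by
  refine ⟨?_, ?_, ?_, ?_⟩ <;> ext j k <;> rcases j with _ | j <;> rcases k with _ | k <;>
    simp [opK, opKinv, opE, opF, mono] <;> intro h <;> simp [h]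

/-- `K (z f) = (Kz) (Kf)`, `K (z^* f) = (Kz^*) (Kf)`. -/
theorem opK_zL (q : Set.Ioo (0 : ℝ) 1) (f : Series) :
    opK q (zL f) = qc q ^ 2 • zL (opK q f) := by
  ext j k
  rcases j with _ | j <;> simp [opK, zL]; ring

theorem opK_sL (q : Set.Ioo (0 : ℝ) 1) (f : Series) :
    opK q (sL q f) = (qc q ^ 2)⁻¹ • sL q (opK q f) := by
  have := qc_ne q
  ext j k
  rcases k with _ | k <;> simp [opK, sL] <;> field_simp <;> ring

theorem opKinv_sL (q : Set.Ioo (0 : ℝ) 1) (f : Series) :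
    opKinv q (sL q f) = qc q ^ 2 • sL q (opKinv q f) := by
  have := qc_ne q
  ext j k
  rcases k with _ | k <;> simp [opKinv, sL] <;> field_simp <;> ring

theorem opK_zR (q : Set.Ioo (0 : ℝ) 1) (f : Series) :
    opK q (zR q f) = qc q ^ 2 • zR q (opK q f) := by
  have := qc_ne q
  ext j k
  rcases j with _ | j <;> simp [opK, zR] <;> field_simp <;> ring

theorem opKinv_zR (q : Set.Ioo (0 : ℝ) 1) (f : Series) :
    opKinv q (zR q f) = (qc q ^ 2)⁻¹ • zR q (opKinv q f) := by
  have := qc_ne q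
  ext j k
  rcases j with _ | j <;> simp [opKinv, zR] <;> field_simp <;> ring

/-- `E (z f) = (Ez) f + (Kz) (Ef)`. -/
theorem opE_zL (q : Set.Ioo (0 : ℝ) 1) (f : Series) :
    opE q (zL f) = -qh q • zL (zL f) + qc q ^ 2 • zL (opE q f) := by
  ext j k
  rcases j with _ | _ | j <;> simp [opE, zL, brk_succ] <;> ring

/-- `E (z^* f) = (Ez^*) f + (Kz^*) (Ef)`. -/
theorem opE_sL (q : Set.Ioo (0 : ℝ) 1) (f : Series) :
    opE q (sL q f) = (qh q ^ 3)⁻¹ • f + (qc q ^ 2)⁻¹ • sL q (opE q f) := by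
  have h := one_sub_ne q
  have h1 := qh_ne q
  rw [← qh_sq, ← pow_mul] at h
  ext j k
  rcases j with _ | _ | j <;> rcases k with _ | _ | k <;>
    simp only [opE, opF, opK, opKinv, sL, zL, zR, brk_pos, brk_neg, LinearMap.coe_mk,
      AddHom.coe_mk, Pi.add_apply, Pi.sub_apply, Pi.smul_apply, smul_eq_mul, upZ_zero, upZ_succ,
      upS_zero, upS_succ] <;>
    simp only [← qh_sq, inv_pow] <;> field_simp <;> ring

/-- `E (f z) = (Ef) z + (Kf) (Ez)`. -/
theorem opE_zR (q : Set.Ioo (0 : ℝ) 1) (f : Series) :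
    opE q (zR q f) = zR q (opE q f) - qh q • zR q (zR q (opK q f)) := by
  have h := one_sub_ne q
  have h1 := qh_ne q
  rw [← qh_sq, ← pow_mul] at h
  ext j k
  rcases j with _ | _ | j <;> rcases k with _ | _ | k <;>
    simp only [opE, opF, opK, opKinv, sL, zL, zR, brk_pos, brk_neg, LinearMap.coe_mk,
      AddHom.coe_mk, Pi.add_apply, Pi.sub_apply, Pi.smul_apply, smul_eq_mul, upZ_zero, upZ_succ,
      upS_zero, upS_succ] <;>
    simp only [← qh_sq, inv_pow] <;> field_simp <;> ring

/-- `F (z f) = (Fz) (K⁻¹f) + z (Ff)`. -/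
theorem opF_zL (q : Set.Ioo (0 : ℝ) 1) (f : Series) :
    opF q (zL f) = qh q • opKinv q f + zL (opF q f) := by
  have h := one_sub_ne q
  have h1 := qh_ne q
  rw [← qh_sq, ← pow_mul] at h
  ext j k
  rcases j with _ | _ | j <;> rcases k with _ | _ | k <;>
    simp only [opE, opF, opK, opKinv, sL, zL, zR, brk_pos, brk_neg, LinearMap.coe_mk,
      AddHom.coe_mk, Pi.add_apply, Pi.sub_apply, Pi.smul_apply, smul_eq_mul, upZ_zero, upZ_succ,
      upS_zero, upS_succ] <;>
    simp only [← qh_sq, inv_pow] <;> field_simp <;> ring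

/-- `F (z^* f) = (Fz^*) (K⁻¹f) + z^* (Ff)`. -/
theorem opF_sL (q : Set.Ioo (0 : ℝ) 1) (f : Series) :
    opF q (sL q f) = -qh q ^ 5 • sL q (sL q (opKinv q f)) + sL q (opF q f) := by
  have h := one_sub_ne q
  have h1 := qh_ne q
  rw [← qh_sq, ← pow_mul] at h
  ext j k
  rcases j with _ | _ | j <;> rcases k with _ | _ | k <;>
    simp only [opE, opF, opK, opKinv, sL, zL, zR, brk_pos, brk_neg, LinearMap.coe_mk,
      AddHom.coe_mk, Pi.add_apply, Pi.sub_apply, Pi.smul_apply, smul_eq_mul, upZ_zero, upZ_succ,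
      upS_zero, upS_succ] <;>
    simp only [← qh_sq, inv_pow] <;> field_simp <;> ring

/-- `F (f z) = (Ff) (K⁻¹z) + f (Fz)`. -/
theorem opF_zR (q : Set.Ioo (0 : ℝ) 1) (f : Series) :
    opF q (zR q f) = (qc q ^ 2)⁻¹ • zR q (opF q f) + qh q • f := by
  have h := one_sub_ne q
  have h1 := qh_ne q
  rw [← qh_sq, ← pow_mul] at h
  ext j k
  rcases j with _ | _ | j <;> rcases k with _ | _ | k <;>
    simp only [opE, opF, opK, opKinv, sL, zL, zR, brk_pos, brk_neg, LinearMap.coe_mk,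
      AddHom.coe_mk, Pi.add_apply, Pi.sub_apply, Pi.smul_apply, smul_eq_mul, upZ_zero, upZ_succ,
      upS_zero, upS_succ] <;>
    simp only [← qh_sq, inv_pow] <;> field_simp <;> ring

/-- The relation `EF - FE = (K - K⁻¹)/(q - q⁻¹)` for the operators. -/
theorem opE_opF (q : Set.Ioo (0 : ℝ) 1) (f : Series) : opE q (opF q f) - opF q (opE q f) =
    (qc q - (qc q)⁻¹)⁻¹ • (opK q f - opKinv q f) := by
  have h := one_sub_ne q
  have h1 := qc_ne q
  have h3 := qh_ne q
  have h2 : (qc q - (qc q)⁻¹)⁻¹ = - qc q / (1 - qc q ^ 2) := by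
    rw [inv_eq_iff_eq_inv, inv_div]
    field_simp
    ring
  rw [h2]
  rw [← qh_sq, ← pow_mul] at h
  ext j k
  rcases j with _ | _ | j <;> rcases k with _ | _ | k <;>
    simp only [opE, opF, opK, opKinv, brk_pos, brk_neg, LinearMap.coe_mk,
      AddHom.coe_mk, Pi.add_apply, Pi.sub_apply, Pi.smul_apply, smul_eq_mul, upZ_zero, upZ_succ,
      upS_zero, upS_succ] <;>
    simp only [← qh_sq, inv_pow, ← pow_mul] <;> field_simp <;> ring

/-! ### Finite functions -/

/-- Vectors killed by some power of `A`. -/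
def nilSub (A : Module.End ℂ Series) : Submodule ℂ Series where
  carrier := {f | ∃ N : ℕ, (A ^ N) f = 0}
  zero_mem' := ⟨0, by simp⟩
  add_mem' := by
    rintro f g ⟨N, hN⟩ ⟨M, hM⟩
    refine ⟨N + M, ?_⟩
    have h1 : (A ^ (N + M)) g = 0 := by rw [pow_add, Module.End.mul_apply, hM, map_zero]
    have h2 : (A ^ (N + M)) f = 0 := by
      rw [add_comm, pow_add, Module.End.mul_apply, hN, map_zero]
    rw [map_add, h1, h2, add_zero]
  smul_mem' := by
    rintro c f ⟨N, hN⟩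
    exact ⟨N, by rw [map_smul, hN, smul_zero]⟩

theorem mem_nilSub {A : Module.End ℂ Series} {f : Series} :
    f ∈ nilSub A ↔ ∃ N : ℕ, (A ^ N) f = 0 := Iff.rfl

theorem pow_zero_of_le {A : Module.End ℂ Series} {f : Series} {N M : ℕ} (h : N ≤ M)
    (hN : (A ^ N) f = 0) : (A ^ M) f = 0 := by
  obtain ⟨k, rfl⟩ := Nat.exists_eq_add_of_le' h
  rw [pow_add, Module.End.mul_apply, hN, map_zero]

theorem nilSub_apply_iff {A : Module.End ℂ Series} {f : Series} :
    A f ∈ nilSub A ↔ f ∈ nilSub A := by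
  constructor
  · rintro ⟨N, hN⟩
    exact ⟨N + 1, by rw [pow_succ, Module.End.mul_apply, hN]⟩
  · rintro ⟨N, hN⟩
    exact ⟨N, by rw [← Module.End.mul_apply, ← pow_succ, pow_succ', Module.End.mul_apply, hN,
      map_zero]⟩

theorem nilSub_map {A T : Module.End ℂ Series} (c : ℂ) (R : Series → Series)
    (h : ∀ f, A (T f) = c • T (A f) + R f) (hR : ∀ f ∈ nilSub A, R f ∈ nilSub A) :
    ∀ f ∈ nilSub A, T f ∈ nilSub A := by
  rintro f ⟨N, hN⟩
  induction N generalizing f with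
  | zero =>
    have : f = 0 := by simpa using hN
    rw [this, map_zero]
    exact zero_mem _
  | succ N ih =>
    have hf : f ∈ nilSub A := ⟨_, hN⟩
    rw [pow_succ, Module.End.mul_apply] at hN
    rw [← nilSub_apply_iff, h]
    exact add_mem (Submodule.smul_mem _ _ (ih _ hN)) (hR f hf)

/-- The space `D(U)_q` of finite functions in the quantum disc: those `f` in `D(U)_q'` with
`z^{*N} f = f z^N = 0` for some `N`. -/
def DU (q : Set.Ioo (0 : ℝ) 1) : Submodule ℂ Series where
  carrier := {f | ∃ N : ℕ, (sL q ^ N) f = 0 ∧ (zR q ^ N) f = 0}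
  zero_mem' := ⟨0, by simp⟩
  add_mem' := by
    rintro f g ⟨N, hN, hN'⟩ ⟨M, hM, hM'⟩
    refine ⟨max N M, ?_, ?_⟩
    · rw [map_add, pow_zero_of_le (le_max_left _ _) hN, pow_zero_of_le (le_max_right _ _) hM,
        add_zero]
    · rw [map_add, pow_zero_of_le (le_max_left _ _) hN', pow_zero_of_le (le_max_right _ _) hM',
        add_zero]
  smul_mem' := by
    rintro c f ⟨N, hN, hN'⟩
    exact ⟨N, by rw [map_smul, hN, smul_zero], by rw [map_smul, hN', smul_zero]⟩

theorem mem_DU {q : Set.Ioo (0 : ℝ) 1} {f : Series} :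
    f ∈ DU q ↔ f ∈ nilSub (sL q) ∧ f ∈ nilSub (zR q) := by
  constructor
  · rintro ⟨N, h, h'⟩
    exact ⟨⟨N, h⟩, ⟨N, h'⟩⟩
  · rintro ⟨⟨N, h⟩, ⟨M, h'⟩⟩
    exact ⟨max N M, pow_zero_of_le (le_max_left _ _) h, pow_zero_of_le (le_max_right _ _) h'⟩

theorem opK_mem (q : Set.Ioo (0 : ℝ) 1) : ∀ f ∈ DU q, opK q f ∈ DU q := by
  intro f hf
  rw [mem_DU] at hf ⊢
  have h0 := qc_ne q
  refine ⟨nilSub_map (qc q ^ 2) (fun _ => 0) (fun f => ?_) (fun _ _ => zero_mem _) f hf.1,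
    nilSub_map (qc q ^ 2)⁻¹ (fun _ => 0) (fun f => ?_) (fun _ _ => zero_mem _) f hf.2⟩
  · rw [opK_sL, smul_smul, mul_inv_cancel₀ (by simpa using h0), one_smul, add_zero]
  · rw [opK_zR, smul_smul, inv_mul_cancel₀ (by simpa using h0), one_smul, add_zero]

theorem opKinv_mem (q : Set.Ioo (0 : ℝ) 1) : ∀ f ∈ DU q, opKinv q f ∈ DU q := by
  intro f hf
  rw [mem_DU] at hf ⊢
  have h0 := qc_ne q
  refine ⟨nilSub_map (qc q ^ 2)⁻¹ (fun _ => 0) (fun f => ?_) (fun _ _ => zero_mem _) f hf.1,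
    nilSub_map (qc q ^ 2) (fun _ => 0) (fun f => ?_) (fun _ _ => zero_mem _) f hf.2⟩
  · rw [opKinv_sL, smul_smul, inv_mul_cancel₀ (by simpa using h0), one_smul, add_zero]
  · rw [opKinv_zR, smul_smul, mul_inv_cancel₀ (by simpa using h0), one_smul, add_zero]

theorem opK_nil_zR (q : Set.Ioo (0 : ℝ) 1) : ∀ f ∈ nilSub (zR q), opK q f ∈ nilSub (zR q) := by
  have h0 := qc_ne q
  refine nilSub_map (qc q ^ 2)⁻¹ (fun _ => 0) (fun f => ?_) (fun _ _ => zero_mem _)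
  rw [opK_zR, smul_smul, inv_mul_cancel₀ (by simpa using h0), one_smul, add_zero]

theorem opKinv_nil_sL (q : Set.Ioo (0 : ℝ) 1) :
    ∀ f ∈ nilSub (sL q), opKinv q f ∈ nilSub (sL q) := by
  have h0 := qc_ne q
  refine nilSub_map (qc q ^ 2)⁻¹ (fun _ => 0) (fun f => ?_) (fun _ _ => zero_mem _)
  rw [opKinv_sL, smul_smul, inv_mul_cancel₀ (by simpa using h0), one_smul, add_zero]

theorem opE_mem (q : Set.Ioo (0 : ℝ) 1) : ∀ f ∈ DU q, opE q f ∈ DU q := by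
  intro f hf
  rw [mem_DU] at hf ⊢
  have h0 : qc q ^ 2 ≠ 0 := pow_ne_zero _ (qc_ne q)
  refine ⟨nilSub_map (qc q ^ 2) (fun f => -(qc q ^ 2 * (qh q ^ 3)⁻¹) • f) (fun f => ?_)
      (fun _ h => Submodule.smul_mem _ _ h) f hf.1,
    nilSub_map 1 (fun f => qh q • zR q (zR q (opK q f))) (fun f => ?_)
      (fun f h => Submodule.smul_mem _ _ (nilSub_apply_iff.2 (nilSub_apply_iff.2
        (opK_nil_zR q f h)))) f hf.2⟩
  · rw [opE_sL, smul_add, smul_smul, smul_smul, mul_inv_cancel₀ h0]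
    module
  · rw [opE_zR]; module

theorem opF_mem (q : Set.Ioo (0 : ℝ) 1) : ∀ f ∈ DU q, opF q f ∈ DU q := by
  intro f hf
  rw [mem_DU] at hf ⊢
  have h0 : qc q ^ 2 ≠ 0 := pow_ne_zero _ (qc_ne q)
  refine ⟨nilSub_map 1 (fun f => qh q ^ 5 • sL q (sL q (opKinv q f))) (fun f => ?_)
      (fun f h => Submodule.smul_mem _ _ (nilSub_apply_iff.2 (nilSub_apply_iff.2
        (opKinv_nil_sL q f h)))) f hf.1,
    nilSub_map (qc q ^ 2) (fun f => -(qc q ^ 2 * qh q) • f) (fun f => ?_)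
      (fun _ h => Submodule.smul_mem _ _ h) f hf.2⟩
  · rw [opF_sL]; module
  · rw [opF_zR, smul_add, smul_smul, smul_smul, mul_inv_cancel₀ h0]
    module

/-- The action of the generators on `D(U)_q`. -/
def genDU (q : Set.Ioo (0 : ℝ) 1) : UqGen → Module.End ℂ (DU q)
  | UqGen.K => (opK q).restrict (opK_mem q)
  | UqGen.Kinv => (opKinv q).restrict (opKinv_mem q)
  | UqGen.E => (opE q).restrict (opE_mem q)
  | UqGen.F => (opF q).restrict (opF_mem q)

/-- The representation of `U_q sl₂` in `D(U)_q`. -/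
def actDU (q : Set.Ioo (0 : ℝ) 1) : UqSl2 q →ₐ[ℂ] Module.End ℂ (DU q) :=
  RingQuot.liftAlgHom ℂ ⟨FreeAlgebra.lift ℂ (genDU q), by
    have h0 := qc_ne q
    intro x y h
    cases h with
    | E_F =>
      simp only [map_mul, map_sub, map_smul, FreeAlgebra.lift_ι_apply, genDU]
      refine LinearMap.ext fun f => Subtype.ext ?_
      exact opE_opF q f
    | _ =>
      simp only [map_mul, map_smul, map_one, FreeAlgebra.lift_ι_apply, genDU]
      refine LinearMap.ext fun f => Subtype.ext ?_
      ext j k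
      rcases j with _ | j <;> rcases k with _ | k <;>
      simp [opK, opKinv, opE, opF] <;> field_simp <;> ring⟩

theorem actDU_gen (q : Set.Ioo (0 : ℝ) 1) (g : UqGen) : actDU q (gen q g) = genDU q g := by
  simp [actDU, gen]

/-! ### The product of finite functions -/

/-- Left multiplication by the power series `∑ a_i z^i`. -/
def cv (a : ℕ → ℂ) : Module.End ℂ Series where
  toFun g := fun m n => ∑ p ∈ Finset.HasAntidiagonal.antidiagonal m, a p.1 * g p.2 n
  map_add' f g := by ext m n; simp [mul_add, Finset.sum_add_distrib]
  map_smul' c f := by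
    ext m n
    simp only [Pi.smul_apply, smul_eq_mul, RingHom.id_apply, Finset.mul_sum]
    exact Finset.sum_congr rfl fun _ _ => by ring

theorem cv_zero (g : Series) : cv 0 g = 0 := by ext m n; simp [cv]

theorem cv_add (a b : ℕ → ℂ) (g : Series) : cv (a + b) g = cv a g + cv b g := by
  ext m n; simp [cv, add_mul, Finset.sum_add_distrib]

theorem zR_cv (q : Set.Ioo (0 : ℝ) 1) (a : ℕ → ℂ) (g : Series) :
    zR q (cv a g) = cv a (zR q g) := by
  ext m n
  rcases m with _ | m
  · simp [zR, cv]; ring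
  · simp only [zR, cv, LinearMap.coe_mk, AddHom.coe_mk, upZ_succ, mul_add,
      Finset.sum_add_distrib]
    congr 1
    · rw [Finset.Nat.sum_antidiagonal_succ', Finset.mul_sum]
      simp only [upZ_zero, upZ_succ, mul_zero, zero_add, add_zero]
      exact Finset.sum_congr rfl fun _ _ => by ring
    · rw [Finset.mul_sum]
      exact Finset.sum_congr rfl fun _ _ => by ring

theorem sL_cv (q : Set.Ioo (0 : ℝ) 1) (a : ℕ → ℂ) (g : Series) :
    sL q (cv a g) = cv (fun i => qc q ^ (2 * i) * a i) (sL q g) +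
      cv (fun i => (1 - qc q ^ (2 * (i + 1))) * a (i + 1)) g := by
  ext m n
  have key : (1 - qc q ^ (2 * (m + 1))) * cv a g (m + 1) n =
      ∑ p ∈ Finset.HasAntidiagonal.antidiagonal m,
        qc q ^ (2 * p.1) * a p.1 * ((1 - qc q ^ (2 * (p.2 + 1))) * g (p.2 + 1) n) +
      ∑ p ∈ Finset.HasAntidiagonal.antidiagonal m, (1 - qc q ^ (2 * (p.1 + 1))) * a (p.1 + 1) * g p.2 n := by
    have e1 := Finset.Nat.sum_antidiagonal_succ' (n := m)
      (f := fun p : ℕ × ℕ => qc q ^ (2 * p.1) * a p.1 * ((1 - qc q ^ (2 * p.2)) * g p.2 n))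
    have e2 := Finset.Nat.sum_antidiagonal_succ (n := m)
      (f := fun p : ℕ × ℕ => (1 - qc q ^ (2 * p.1)) * a p.1 * g p.2 n)
    simp only [mul_zero, pow_zero, sub_self, zero_mul, add_zero, zero_add] at e1 e2
    rw [← e1, ← e2, ← Finset.sum_add_distrib]
    simp only [cv, LinearMap.coe_mk, AddHom.coe_mk, Finset.mul_sum]
    refine Finset.sum_congr rfl fun p hp => ?_
    rw [← Finset.HasAntidiagonal.mem_antidiagonal.1 hp, mul_add, pow_add]
    ring
  have key2 : qc q ^ (2 * m) * upS (cv a g) m n = ∑ p ∈ Finset.HasAntidiagonal.antidiagonal m,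
      qc q ^ (2 * p.1) * a p.1 * (qc q ^ (2 * p.2) * upS g p.2 n) := by
    rcases n with _ | n
    · simp
    · simp only [upS_succ, cv, LinearMap.coe_mk, AddHom.coe_mk, Finset.mul_sum]
      refine Finset.sum_congr rfl fun p hp => ?_
      rw [← Finset.HasAntidiagonal.mem_antidiagonal.1 hp, mul_add, pow_add]
      ring
  have e : sL q (cv a g) m n = qc q ^ (2 * m) * upS (cv a g) m n +
    (1 - qc q ^ (2 * (m + 1))) * cv a g (m + 1) n := rfl
  rw [e, key, key2, ← add_assoc, ← Finset.sum_add_distrib]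
  simp only [cv, sL, LinearMap.coe_mk, AddHom.coe_mk, Pi.add_apply]
  congr 1
  exact Finset.sum_congr rfl fun p _ => by ring

/-- The product `f g = ∑_{j,k} a_{jk} z^j (z^{*k} g)` of a distribution `f = ∑ a_{jk} z^j z^{*k}`
and a finite function `g`: the extension by continuity in `f` of the left multiplication by
polynomials. Only finitely many `k` contribute, as `z^{*N} g = 0` for some `N`. -/
def mulS (q : Set.Ioo (0 : ℝ) 1) (f g : Series) : Series :=
  ∑ᶠ k : ℕ, cv (fun j => f j k) ((sL q ^ k) g)

theorem mulS_eq (q : Set.Ioo (0 : ℝ) 1) (f g : Series) {N : ℕ} (h : (sL q ^ N) g = 0) :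
    mulS q f g = ∑ k ∈ Finset.range N, cv (fun j => f j k) ((sL q ^ k) g) := by
  refine finsum_eq_sum_of_support_subset _ fun k hk => ?_
  by_contra hN
  simp only [Finset.coe_range, Set.mem_Iio, not_lt] at hN
  exact hk (by simp only; rw [pow_zero_of_le hN h, map_zero])

theorem mulS_add (q : Set.Ioo (0 : ℝ) 1) (f : Series) {g g' : Series} (hg : g ∈ nilSub (sL q))
    (hg' : g' ∈ nilSub (sL q)) : mulS q f (g + g') = mulS q f g + mulS q f g' := by
  obtain ⟨N, hN⟩ := hg
  obtain ⟨M, hM⟩ := hg'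
  have h1 := pow_zero_of_le (le_max_left N M) hN
  have h2 := pow_zero_of_le (le_max_right N M) hM
  rw [mulS_eq q f g h1, mulS_eq q f g' h2,
    mulS_eq q f (g + g') (N := max N M) (by rw [map_add, h1, h2, add_zero]),
    ← Finset.sum_add_distrib]
  simp

theorem mulS_smul (q : Set.Ioo (0 : ℝ) 1) (f : Series) (c : ℂ) {g : Series}
    (hg : g ∈ nilSub (sL q)) : mulS q f (c • g) = c • mulS q f g := by
  obtain ⟨N, hN⟩ := hg
  rw [mulS_eq q f g hN, mulS_eq q f (c • g) (N := N) (by rw [map_smul, hN, smul_zero]),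
    Finset.smul_sum]
  simp

theorem zR_sL_pow (q : Set.Ioo (0 : ℝ) 1) (k : ℕ) (g : Series) :
    zR q ((sL q ^ k) g) = (sL q ^ k) (zR q g) := by
  induction k with
  | zero => simp
  | succ k ih => rw [pow_succ', Module.End.mul_apply, Module.End.mul_apply, zR_sL, ih]

/-- `(f g) z = f (g z)`. -/
theorem zR_mulS (q : Set.Ioo (0 : ℝ) 1) (f : Series) {g : Series} (hg : g ∈ nilSub (sL q)) :
    zR q (mulS q f g) = mulS q f (zR q g) := by
  obtain ⟨N, hN⟩ := hg
  rw [mulS_eq q f g hN, mulS_eq q f (zR q g) (N := N) (by rw [← zR_sL_pow, hN, map_zero]),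
    map_sum]
  exact Finset.sum_congr rfl fun k _ => by rw [zR_cv, zR_sL_pow]

/-- `z^* (f g) = (z^* f) g`. -/
theorem sL_mulS (q : Set.Ioo (0 : ℝ) 1) (f : Series) {g : Series} (hg : g ∈ nilSub (sL q)) :
    sL q (mulS q f g) = mulS q (sL q f) g := by
  obtain ⟨N, hN⟩ := hg
  have hN1 := pow_zero_of_le (Nat.le_succ N) hN
  rw [mulS_eq q f g hN, mulS_eq q (sL q f) g hN1, map_sum]
  have e : ∀ k, cv (fun j => sL q f j k) ((sL q ^ k) g) =
      cv (fun j => qc q ^ (2 * j) * upS f j k) ((sL q ^ k) g) +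
      cv (fun j => (1 - qc q ^ (2 * (j + 1))) * f (j + 1) k) ((sL q ^ k) g) := by
    intro k
    rw [← cv_add]
    rfl
  simp only [e, Finset.sum_add_distrib, sL_cv]
  congr 1
  · rw [Finset.sum_range_succ']
    have : (fun j => qc q ^ (2 * j) * upS f j 0) = 0 := by ext j; simp
    rw [this, cv_zero, add_zero]
    exact Finset.sum_congr rfl fun k _ => by
      rw [pow_succ', Module.End.mul_apply]; simp
  · rw [Finset.sum_range_succ, hN, map_zero, add_zero]

theorem mulS_mem (q : Set.Ioo (0 : ℝ) 1) {f g : Series} (hf : f ∈ DU q) (hg : g ∈ DU q) :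
    mulS q f g ∈ DU q := by
  have hgL := (mem_DU.1 hg).1
  rw [mem_DU]
  constructor
  · obtain ⟨N, hN⟩ := (mem_DU.1 hf).1
    refine ⟨N, ?_⟩
    have : ∀ (N : ℕ) (f : Series), (sL q ^ N) (mulS q f g) = mulS q ((sL q ^ N) f) g := by
      intro N
      induction N with
      | zero => simp
      | succ N ih => intro f; rw [pow_succ, Module.End.mul_apply, sL_mulS q f hgL, ih]; rfl
    rw [this, hN]
    have : (fun k : ℕ => cv (fun j => (0 : Series) j k) ((sL q ^ k) g)) = fun _ => 0 :=
      funext fun k => cv_zero _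
    rw [mulS, this, finsum_zero]
  · obtain ⟨N, hN⟩ := (mem_DU.1 hg).2
    refine ⟨N, ?_⟩
    have : ∀ (N : ℕ) (g : Series), g ∈ nilSub (sL q) →
        (zR q ^ N) (mulS q f g) = mulS q f ((zR q ^ N) g) := by
      intro N
      induction N with
      | zero => simp
      | succ N ih =>
        intro g hg
        have : zR q g ∈ nilSub (sL q) := by
          obtain ⟨M, hM⟩ := hg
          exact ⟨M, by rw [← zR_sL_pow, hM, map_zero]⟩
        rw [pow_succ, Module.End.mul_apply, zR_mulS q f hg, ih _ this]; rfl
    rw [this N g hgL, hN]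
    simp [mulS]

/-- The product of the algebra `D(U)_q`. -/
instance instMulDU (q : Set.Ioo (0 : ℝ) 1) : Mul (DU q) :=
  ⟨fun f g => ⟨mulS q f g, mulS_mem q f.2 g.2⟩⟩

/-! ### The representations in `H̃` and the functional `η` -/

/-- `H̃ = {f ∈ D(U)_q | f z = 0}`. -/
def Htilde (q : Set.Ioo (0 : ℝ) 1) : Submodule ℂ Series :=
  DU q ⊓ LinearMap.ker (zR q)

/-- The inclusion `H̃ ⊆ D(U)_q`. -/
def inclH (q : Set.Ioo (0 : ℝ) 1) : Htilde q →ₗ[ℂ] DU q :=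
  Submodule.inclusion inf_le_left

theorem zR_inclH (q : Set.Ioo (0 : ℝ) 1) (h : Htilde q) : zR q (inclH q h : Series) = 0 := h.2.2

/-- The representation `T̃` of `D(U)_q` in `H̃`: `T̃(f) h = f h`. -/
def Ttilde (q : Set.Ioo (0 : ℝ) 1) (f : DU q) : Module.End ℂ (Htilde q) where
  toFun h := ⟨(f * inclH q h : DU q), (f * inclH q h : DU q).2, by
    change zR q (mulS q f (inclH q h)) = 0
    rw [zR_mulS q f (mem_DU.1 (inclH q h).2).1, zR_inclH]
    simp [mulS]⟩
  map_add' h h' := Subtype.ext <|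
    mulS_add q f (mem_DU.1 (inclH q h).2).1 (mem_DU.1 (inclH q h').2).1
  map_smul' c h := Subtype.ext <| mulS_smul q f c (mem_DU.1 (inclH q h).2).1

theorem zR_act (q : Set.Ioo (0 : ℝ) 1) (a : UqSl2 q) (ha : a ∈ UqB q) :
    ∀ h : DU q, zR q (h : Series) = 0 → zR q (actDU q a h : Series) = 0 := by
  have h0 : qc q ^ 2 ≠ 0 := pow_ne_zero _ (qc_ne q)
  have hK : ∀ f : Series, zR q f = 0 → zR q (opK q f) = 0 := by
    intro f hf
    have := opK_zR q f
    rw [hf, map_zero] at this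
    exact ((smul_eq_zero.1 this.symm).resolve_left h0)
  induction ha using Algebra.adjoin_induction with
  | mem x hx =>
    intro h hh
    rcases hx with rfl | rfl | rfl
    · rw [actDU_gen]
      exact hK _ hh
    · rw [actDU_gen]
      have := opKinv_zR q h
      rw [hh, map_zero] at this
      exact ((smul_eq_zero.1 this.symm).resolve_left (inv_ne_zero h0))
    · rw [actDU_gen]
      have := opE_zR q h
      rw [hh, hK _ hh, map_zero, map_zero, smul_zero, sub_zero] at this
      exact this.symm
  | algebraMap r =>
    intro h hh
    rw [AlgHom.commutes]
    change zR q (r • (h : Series)) = 0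
    rw [map_smul, hh, smul_zero]
  | add x y _ _ hx hy =>
    intro h hh
    rw [map_add]
    change zR q ((actDU q x h : Series) + (actDU q y h : Series)) = 0
    rw [map_add, hx h hh, hy h hh, add_zero]
  | mul x y _ _ hx hy =>
    intro h hh
    rw [map_mul]
    exact hx _ (hy h hh)

/-- The representation `Γ̃` of `U_q b₊` in `H̃`, the restriction of the action on `D(U)_q`. -/
def Gtilde (q : Set.Ioo (0 : ℝ) 1) : UqB q →ₐ[ℂ] Module.End ℂ (Htilde q) where
  toFun a :=
    { toFun := fun h => ⟨actDU q a (inclH q h), (actDU q a (inclH q h)).2,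
        zR_act q a a.2 _ (zR_inclH q h)⟩
      map_add' := fun h h' => Subtype.ext (by simp)
      map_smul' := fun c h => Subtype.ext (by simp) }
  map_one' := by
    refine LinearMap.ext fun h => Subtype.ext ?_
    simp
    rfl
  map_mul' a b := by
    refine LinearMap.ext fun h => Subtype.ext ?_
    simp
    rfl
  map_zero' := by
    refine LinearMap.ext fun h => Subtype.ext ?_
    simp
  map_add' a b := by
    refine LinearMap.ext fun h => Subtype.ext ?_
    simp
  commutes' r := by
    refine LinearMap.ext fun h => Subtype.ext ?_
    simp
    rfl

/-- The trace of a linear operator `L` of finite rank in a (possibly infinite-dimensional) space: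
the trace of the restriction of `L` to its finite-dimensional image. -/
def finTrace {V : Type*} [AddCommGroup V] [Module ℂ V] (L : Module.End ℂ V) : ℂ :=
  LinearMap.trace ℂ (LinearMap.range L)
    (L.restrict (p := LinearMap.range L) (q := LinearMap.range L)
      fun v _ => LinearMap.mem_range_self L v)

/-- The functional `η(f) = tr(T̃(f) Γ̃(K⁻¹))`. -/
def eta (q : Set.Ioo (0 : ℝ) 1) (f : DU q) : ℂ :=
  finTrace (Ttilde q f * Gtilde q (KinvB q))

/-! ### The integral over the quantum disc -/

/-- The polynomial `z^k z^{*k} = ∏_{i<k} (1 - q^{-2i} y)` in `y = 1 - z z^*`, evaluated at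
`y = q^{2n}`. It vanishes for `k > n`. -/
def zzVal (q : Set.Ioo (0 : ℝ) 1) (k n : ℕ) : ℂ :=
  ∏ i ∈ Finset.range k, (1 - (qc q)⁻¹ ^ (2 * i) * qc q ^ (2 * n))

theorem zL_mono (j k : ℕ) : zL (mono j k) = mono (j + 1) k := by
  ext m n
  rcases m with _ | m <;> simp [zL, mono]

theorem sL_mono_zero (q : Set.Ioo (0 : ℝ) 1) (k : ℕ) :
    sL q (mono 0 k) = mono 0 (k + 1) := by
  ext m n
  rcases m with _ | m <;> rcases n with _ | n <;> simp [sL, mono]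

theorem sL_mono_succ (q : Set.Ioo (0 : ℝ) 1) (j k : ℕ) :
    sL q (mono (j + 1) k) = qc q ^ (2 * (j + 1)) • mono (j + 1) (k + 1) +
      (1 - qc q ^ (2 * (j + 1))) • mono j k := by
  ext m n
  by_cases h1 : m = j
  · subst h1
    rcases n with _ | n <;> simp [sL, mono]
  · by_cases h2 : m = j + 1
    · subst h2
      rcases n with _ | n <;> simp [sL, mono]
    · rcases n with _ | n <;> simp [sL, mono, h1, h2]

/-- `z^{k+1} z^{*(k+1)} = (1 - q^{-2k} y) z^k z^{*k}`. -/
theorem mono_succ (q : Set.Ioo (0 : ℝ) 1) (k : ℕ) : mono (k + 1) (k + 1) =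
    mono k k - (qc q)⁻¹ ^ (2 * k) • (mono k k - zL (sL q (mono k k))) := by
  have h0 : qc q ^ (2 * k) ≠ 0 := pow_ne_zero _ (qc_ne q)
  rcases k with _ | k
  · simp [sL_mono_zero, zL_mono]
  · rw [sL_mono_succ, map_add, map_smul, map_smul, zL_mono, zL_mono]
    have : mono (k + 1) (k + 1) - (qc q ^ (2 * (k + 1)) • mono (k + 1 + 1) (k + 1 + 1) +
        (1 - qc q ^ (2 * (k + 1))) • mono (k + 1) (k + 1)) = qc q ^ (2 * (k + 1)) •
        (mono (k + 1) (k + 1) - mono (k + 1 + 1) (k + 1 + 1)) := by module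
    rw [this, smul_smul, inv_pow, inv_mul_cancel₀ h0, one_smul, sub_sub_cancel]

theorem zzVal_self_ne (q : Set.Ioo (0 : ℝ) 1) (n : ℕ) : zzVal q n n ≠ 0 := by
  refine Finset.prod_ne_zero_iff.2 fun i hi => ?_
  have hi := Finset.mem_range.1 hi
  have h0 := qc_ne q
  have : (qc q)⁻¹ ^ (2 * i) * qc q ^ (2 * n) = qc q ^ (2 * (n - i)) := by
    rw [show 2 * n = 2 * i + 2 * (n - i) by omega, pow_add, ← mul_assoc, ← mul_pow,
      inv_mul_cancel₀ h0, one_pow, one_mul]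
  rw [this]
  exact sub_ne_zero.2 (qc_pow_ne_one q (by omega)).symm

/-- The coefficients `c_k` of the series `ψ(y) = ∑ c_k z^k z^{*k}`, where `ψ` is a function on
`{q^{2n}}`, written as `φ n = ψ(q^{2n})`. They are determined by
`∑_k c_k (z^k z^{*k})(q^{2n}) = ψ(q^{2n})`. -/
def yCoeff (q : Set.Ioo (0 : ℝ) 1) (φ : ℕ → ℂ) (n : ℕ) : ℂ :=
  (φ n - ∑ k : Fin n, yCoeff q φ k * zzVal q k n) / zzVal q n n
termination_by n
decreasing_by exact k.2

theorem yCoeff_spec (q : Set.Ioo (0 : ℝ) 1) (φ : ℕ → ℂ) (n : ℕ) :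
    ∑ k ∈ Finset.range (n + 1), yCoeff q φ k * zzVal q k n = φ n := by
  rw [Finset.sum_range_succ, yCoeff, div_mul_cancel₀ _ (zzVal_self_ne q n),
    Finset.sum_range (fun k => yCoeff q φ k * zzVal q k n)]
  ring

/-- The distribution `ψ(y)`, `y = 1 - z z^*`, for a function `ψ` on `{q^{2n} | n ≥ 0}`, written as
`φ n = ψ(q^{2n})`. -/
def funY (q : Set.Ioo (0 : ℝ) 1) (φ : ℕ → ℂ) : Series :=
  fun j k => if j = k then yCoeff q φ k else 0

/-- The sum `∑_{j>0} z^j ψ_j(y) + ψ_0(y) + ∑_{j>0} ψ_{-j}(y) z^{*j}` for a family of functions on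
`{q^{2n}}` with finitely many nonzero values in total; `ψ j n` is `ψ_j(q^{2n})`. -/
def ofParts (q : Set.Ioo (0 : ℝ) 1) (ψ : ℤ →₀ ℕ →₀ ℂ) : Series :=
  ∑ j ∈ ψ.support, if 0 ≤ j then (zL ^ j.toNat) (funY q (ψ j)) else (sR ^ (-j).toNat) (funY q (ψ j))

open Classical in
/-- The components `ψ_j` of `f`. -/
def parts (q : Set.Ioo (0 : ℝ) 1) (f : Series) : ℤ →₀ ℕ →₀ ℂ :=
  if h : ∃ ψ, f = ofParts q ψ then h.choose else 0

/-- The integral `∫_{U_q} f dν = (1 - q²) ∑_n ψ_0(q^{2n}) q^{-2n}`. -/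
def nuIntegral (q : Set.Ioo (0 : ℝ) 1) (f : DU q) : ℂ :=
  (1 - qc q ^ 2) * (parts q f 0).sum fun n c => c * (qc q)⁻¹ ^ (2 * n)

end QDisc

end

open QDisc

/-!
The vacuum projection `f₀`, the function of `y` supported at `y = 1`, satisfies `z^* f₀ = f₀ z = 0`,
and up to a scalar it is the only distribution that does. Lowering a finite function by `z^*` on the
left and by `z` on the right until it vanishes therefore shows that the matrix units `z^m f₀ z^{*n}`
span `D(U)_q`. On `H̃` the product `f₀ h` is the multiple of `f₀` by the constant term of `h`, so a
matrix unit acts with rank one and `η (z^m f₀ z^{*n}) = δ_{mn} q^{-2m} (q²; q²)_m`.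

The generators `K` and `E` act on matrix units by explicit formulas, from which their invariance is
read off. The transposition `z^j z^{*k} ↦ z^k z^{*j}` preserves `η` and conjugates `q² E` into `F`,
so the invariance under `F` is that under `E`.

Finally `z^m f₀ z^{*m}` is `(q²; q²)_m` times the function of `y` supported at `q^{2m}`. This
decomposes every finite function, and shows `∫ f dν = (1 - q²) η(f)` on matrix units.
-/

noncomputable section

namespace QDisc

/-! ### Linear algebra -/

/-- Subtracting from `f` a lift in `W` of `A f` leaves a vector of `ker A`. -/
theorem mem_of_pow_apply_eq_zero {R M : Type*} [Ring R] [AddCommGroup M] [Module R M]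
    {A : Module.End R M} {P W : Submodule R M} (hP : ∀ f ∈ P, A f ∈ P)
    (hker : P ⊓ LinearMap.ker A ≤ W) (hlift : W ≤ (W ⊓ P).map A) {N : ℕ} {f : M} (hf : f ∈ P)
    (hN : (A ^ N) f = 0) : f ∈ W := by
  induction N generalizing f with
  | zero => exact (show f = 0 by simpa using hN) ▸ zero_mem W
  | succ N ih =>
    obtain ⟨g, ⟨hgW, hgP⟩, hg⟩ := hlift (ih (hP f hf) (by rwa [pow_succ] at hN))
    have hfg : f - g ∈ W := hker ⟨sub_mem hf hgP, by simp [hg]⟩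
    simpa using add_mem hfg hgW

/-- The operators of finite rank. -/
def finiteRank (K V : Type*) [Field K] [AddCommGroup V] [Module K V] :
    Submodule K (Module.End K V) where
  carrier := {L | FiniteDimensional K (LinearMap.range L)}
  zero_mem' := Submodule.finiteDimensional_of_le (LinearMap.range_zero.le.trans bot_le :
    LinearMap.range (0 : Module.End K V) ≤ (⊥ : Submodule K V))
  add_mem' {L L'} (_ : FiniteDimensional K (LinearMap.range L))
      (_ : FiniteDimensional K (LinearMap.range L')) :=
    Submodule.finiteDimensional_of_le (LinearMap.range_add_le L L')
  smul_mem' c L (_ : FiniteDimensional K (LinearMap.range L)) :=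
    Submodule.finiteDimensional_of_le (LinearMap.range_smul_le_range L c)

theorem range_smulRight_le_span {K V : Type*} [Field K] [AddCommGroup V] [Module K V]
    (φ : V →ₗ[K] K) (v : V) : LinearMap.range (φ.smulRight v) ≤ Submodule.span K {v} := by
  rintro _ ⟨w, rfl⟩
  exact Submodule.smul_mem _ _ (Submodule.mem_span_singleton_self v)

theorem smulRight_mem_finiteRank {K V : Type*} [Field K] [AddCommGroup V] [Module K V]
    (φ : V →ₗ[K] K) (v : V) : φ.smulRight v ∈ finiteRank K V :=
  Submodule.finiteDimensional_of_le (range_smulRight_le_span φ v)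

section Trace

variable {V : Type*} [AddCommGroup V] [Module ℂ V]

theorem finTrace_eq_trace_restrict (L : Module.End ℂ V) (W : Submodule ℂ V)
    [FiniteDimensional ℂ W] (h : LinearMap.range L ≤ W) :
    finTrace L = LinearMap.trace ℂ W
      (L.restrict (p := W) (q := W) fun v _ => h (LinearMap.mem_range_self L v)) := by
  have : FiniteDimensional ℂ (LinearMap.range L) := Submodule.finiteDimensional_of_le h
  exact LinearMap.trace_comp_comm' (Submodule.inclusion h) (L.rangeRestrict ∘ₗ W.subtype)

theorem finTrace_smulRight (φ : V →ₗ[ℂ] ℂ) (v : V) : finTrace (φ.smulRight v) = φ v := by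
  have hv : v ∈ Submodule.span ℂ {v} := Submodule.mem_span_singleton_self v
  rw [finTrace_eq_trace_restrict _ _ (range_smulRight_le_span φ v)]
  exact LinearMap.trace_smulRight (φ ∘ₗ Submodule.subtype _) ⟨v, hv⟩

/-- `finTrace` as a linear functional on the operators of finite rank. -/
def finTraceₗ (V : Type*) [AddCommGroup V] [Module ℂ V] : finiteRank ℂ V →ₗ[ℂ] ℂ where
  toFun L := finTrace L.1
  map_add' L L' := by
    have : FiniteDimensional ℂ (LinearMap.range L.1) := L.2
    have : FiniteDimensional ℂ (LinearMap.range L'.1) := L'.2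
    set W := LinearMap.range L.1 ⊔ LinearMap.range L'.1
    rw [finTrace_eq_trace_restrict (L + L').1 W (LinearMap.range_add_le L.1 L'.1),
      finTrace_eq_trace_restrict L.1 W le_sup_left, finTrace_eq_trace_restrict L'.1 W le_sup_right,
      ← map_add]
    rfl
  map_smul' c L := by
    have : FiniteDimensional ℂ (LinearMap.range L.1) := L.2
    rw [finTrace_eq_trace_restrict (c • L).1 _ (LinearMap.range_smul_le_range L.1 c), finTrace,
      RingHom.id_apply, ← map_smul]
    rfl

end Trace

variable {q : Set.Ioo (0 : ℝ) 1}

/-! ### Invariant integrals -/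

@[elab_as_elim]
theorem UqSl2_induction {p : UqSl2 q → Prop} (gen : ∀ g, p (gen q g))
    (algebraMap : ∀ r : ℂ, p (algebraMap ℂ _ r)) (add : ∀ a b, p a → p b → p (a + b))
    (mul : ∀ a b, p a → p b → p (a * b)) (a : UqSl2 q) : p a := by
  obtain ⟨a, rfl⟩ := RingQuot.mkAlgHom_surjective ℂ (UqRel q) a
  induction a using FreeAlgebra.induction with
  | grade0 r => rw [AlgHom.commutes]; exact algebraMap r
  | grade1 g => exact gen g
  | mul a b ha hb => rw [map_mul]; exact mul _ _ ha hb
  | add a b ha hb => rw [map_add]; exact add _ _ ha hb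

theorem gen_K_mul_gen_Kinv : gen q UqGen.K * gen q UqGen.Kinv = 1 :=
  (map_mul _ _ _).symm.trans ((RingQuot.mkAlgHom_rel ℂ UqRel.K_Kinv).trans (map_one _))

theorem counit_gen (g : UqGen) : counit q (gen q g) = match g with
    | UqGen.K => 1
    | UqGen.Kinv => 1
    | UqGen.E => 0
    | UqGen.F => 0 := by
  cases g <;>
    simp only [counit, gen, RingQuot.liftAlgHom_mkAlgHom_apply, FreeAlgebra.lift_ι_apply]

section InvariantIntegral

variable {V : Type*} [AddCommGroup V] [Module ℂ V] {ρ : UqSl2 q →ₐ[ℂ] Module.End ℂ V}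

theorem isInvariantIntegral_of_gen (η : V →ₗ[ℂ] ℂ) (hK : ∀ v, η (ρ (gen q UqGen.K) v) = η v)
    (hE : ∀ v, η (ρ (gen q UqGen.E) v) = 0) (hF : ∀ v, η (ρ (gen q UqGen.F) v) = 0) :
    IsInvariantIntegral ρ η where
  linear := η.isLinear
  equivariant a := by
    have hKinv (v : V) : η (ρ (gen q UqGen.Kinv) v) = η v := by
      rw [← hK, ← Module.End.mul_apply, ← map_mul, gen_K_mul_gen_Kinv, map_one,
        Module.End.one_apply]
    induction a using UqSl2_induction with
    | gen g =>
      rw [counit_gen]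
      cases g with
      | K => simpa using hK
      | Kinv => simpa using hKinv
      | E => simpa using hE
      | F => simpa using hF
    | algebraMap r => simp
    | add a b ha hb => simp [ha, hb, add_mul]
    | mul a b ha hb => simp [ha, hb, mul_assoc]

theorem IsInvariantIntegral.const_mul {η : V → ℂ} (h : IsInvariantIntegral ρ η) (c : ℂ) :
    IsInvariantIntegral ρ fun v => c * η v where
  linear := ((h.linear.mk' η).lcomp ℂ ℂ (LinearMap.mulLeft ℂ c)).isLinear
  equivariant a v := by rw [h.equivariant, mul_left_comm]

end InvariantIntegral

/-! ### Functions of `y` -/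

theorem zzVal_eq_zero {k n : ℕ} (h : n < k) : zzVal q k n = 0 := by
  refine Finset.prod_eq_zero (Finset.mem_range.2 h) ?_
  rw [← mul_pow, inv_mul_cancel₀ (qc_ne q), one_pow, sub_self]

theorem zzVal_succ (k n : ℕ) :
    zzVal q (k + 1) n = zzVal q k n * (1 - (qc q)⁻¹ ^ (2 * k) * qc q ^ (2 * n)) :=
  Finset.prod_range_succ _ _

theorem zzVal_succ_succ (k n : ℕ) :
    zzVal q (k + 1) (n + 1) = (1 - qc q ^ (2 * (n + 1))) * zzVal q k n := by
  have h0 := qc_ne q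
  rw [zzVal, Finset.prod_range_succ', mul_comm, zzVal]
  congr 1
  · simp
  · refine Finset.prod_congr rfl fun i _ => ?_
    rw [inv_pow, inv_pow]
    field_simp
    ring

theorem yCoeff_unique {φ c : ℕ → ℂ}
    (h : ∀ n, ∑ k ∈ Finset.range (n + 1), c k * zzVal q k n = φ n) : yCoeff q φ = c := by
  funext n
  induction n using Nat.strong_induction_on with
  | _ n ih =>
    have hn := (yCoeff_spec q φ n).trans (h n).symm
    rw [Finset.sum_range_succ, Finset.sum_range_succ,
      Finset.sum_congr rfl fun k hk => by rw [ih k (Finset.mem_range.1 hk)]] at hn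
    exact mul_right_cancel₀ (zzVal_self_ne q n) (add_left_cancel hn)

theorem yCoeff_injective : Function.Injective (yCoeff q) := fun φ ψ h => by
  funext n
  rw [← yCoeff_spec q φ n, h, yCoeff_spec]

/-- `ψ ↦ ψ(y)` as a linear map. -/
def funYₗ (q : Set.Ioo (0 : ℝ) 1) : (ℕ → ℂ) →ₗ[ℂ] Series where
  toFun := funY q
  map_add' φ ψ := by
    have h : yCoeff q (φ + ψ) = yCoeff q φ + yCoeff q ψ := yCoeff_unique fun n => by
      simp only [Pi.add_apply, add_mul, Finset.sum_add_distrib, yCoeff_spec]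
    ext j k
    simp only [funY, h, Pi.add_apply]
    split_ifs <;> simp
  map_smul' c φ := by
    have h : yCoeff q (c • φ) = c • yCoeff q φ := yCoeff_unique fun n => by
      simp only [Pi.smul_apply, smul_eq_mul, mul_assoc, ← Finset.mul_sum, yCoeff_spec]
    ext j k
    simp only [funY, h, Pi.smul_apply, RingHom.id_apply, smul_eq_mul]
    split_ifs <;> simp

theorem funYₗ_apply (φ : ℕ → ℂ) : funYₗ q φ = funY q φ := rfl

/-- `z^* ψ(y) = ψ(q² y) z^*`. -/
theorem sL_funY (φ : ℕ → ℂ) : sL q (funY q φ) = sR (funY q fun n => φ (n + 1)) := by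
  have h0 := qc_ne q
  have hstep (k n : ℕ) : (1 - qc q ^ (2 * (k + 1))) * zzVal q k n +
      qc q ^ (2 * (k + 1)) * zzVal q (k + 1) n = zzVal q (k + 1) (n + 1) := by
    rw [zzVal_succ, zzVal_succ_succ, inv_pow]
    field_simp
    ring
  have hcoeff : yCoeff q (fun n => φ (n + 1)) = fun k =>
      qc q ^ (2 * k) * yCoeff q φ k + (1 - qc q ^ (2 * (k + 1))) * yCoeff q φ (k + 1) := by
    refine yCoeff_unique fun n => ?_
    have hlast : ∑ k ∈ Finset.range (n + 1), qc q ^ (2 * k) * yCoeff q φ k * zzVal q k n =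
        ∑ k ∈ Finset.range (n + 1),
          qc q ^ (2 * (k + 1)) * yCoeff q φ (k + 1) * zzVal q (k + 1) n + yCoeff q φ 0 := by
      rw [← add_zero (∑ k ∈ Finset.range (n + 1), _), ← mul_zero (qc q ^ (2 * (n + 1)) *
        yCoeff q φ (n + 1)), ← zzVal_eq_zero (Nat.lt_succ_self n), ← Finset.sum_range_succ,
        Finset.sum_range_succ']
      simp [zzVal]
    rw [← yCoeff_spec q φ (n + 1), Finset.sum_range_succ' _ (n + 1)]
    simp only [add_mul, Finset.sum_add_distrib]
    rw [hlast, add_right_comm, ← Finset.sum_add_distrib]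
    congr 1
    · exact Finset.sum_congr rfl fun k _ => by rw [← hstep]; ring
    · simp [zzVal]
  ext j k
  rcases k with _ | k
  · simp [sL, sR, funY]
  · by_cases hjk : j = k
    · simp [sL, sR, funY, hcoeff, hjk]
    · simp [sL, sR, funY, hjk]

/-- `z ψ(y) z^* = (1 - y) ψ(q⁻² y)`. -/
theorem zL_sR_funY (φ : ℕ → ℂ) :
    zL (sR (funY q φ)) = funY q fun n => (1 - qc q ^ (2 * n)) * φ (n - 1) := by
  have hcoeff : yCoeff q (fun n => (1 - qc q ^ (2 * n)) * φ (n - 1)) =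
      fun k => k.casesOn 0 (yCoeff q φ) := by
    refine yCoeff_unique fun n => ?_
    cases n with
    | zero => simp
    | succ n =>
      rw [Finset.sum_range_succ', Nat.add_sub_cancel, ← yCoeff_spec q φ n,
        Finset.mul_sum]
      simp [zzVal_succ_succ, mul_left_comm]
  ext j k
  rcases j with _ | j <;> rcases k with _ | k <;> simp [zL, sR, funY, hcoeff]

theorem opK_funY (φ : ℕ → ℂ) : opK q (funY q φ) = funY q φ := by
  ext j k
  by_cases hjk : j = k
  · simp [opK, hjk, qc_ne q]
  · simp [opK, funY, hjk]

/-! ### Transposition -/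

/-- The linear involution `z^j z^{*k} ↦ z^k z^{*j}` of `D(U)_q'`. -/
def transpose : Module.End ℂ Series where
  toFun f := fun j k => f k j
  map_add' _ _ := rfl
  map_smul' _ _ := rfl

theorem zL_transpose (f : Series) : zL (transpose f) = transpose (sR f) := by
  ext j k
  cases j <;> simp [zL, sR, transpose]

theorem sR_transpose (f : Series) : sR (transpose f) = transpose (zL f) := by
  ext j k
  cases k <;> simp [zL, sR, transpose]

theorem sL_transpose (f : Series) : sL q (transpose f) = transpose (zR q f) := by
  ext j k
  cases k <;> simp [sL, zR, transpose]

theorem zR_transpose (f : Series) : zR q (transpose f) = transpose (sL q f) := by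
  ext j k
  cases j <;> simp [sL, zR, transpose]

theorem transpose_funY (φ : ℕ → ℂ) : transpose (funY q φ) = funY q φ := by
  ext j k
  by_cases hjk : j = k
  · simp [transpose, hjk]
  · simp [transpose, funY, hjk, Ne.symm hjk]

theorem opF_transpose (f : Series) : opF q (transpose f) = qc q ^ 2 • transpose (opE q f) := by
  have h := qh_ne q
  ext j k
  cases k with
  | zero =>
    simp only [opF, opE, transpose, LinearMap.coe_mk, AddHom.coe_mk, Pi.smul_apply, smul_eq_mul,
      upS_zero, upZ_zero, ← qh_sq]
    field_simp
    ring
  | succ k =>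
    simp only [opF, opE, transpose, LinearMap.coe_mk, AddHom.coe_mk, Pi.smul_apply, smul_eq_mul,
      upS_succ, upZ_succ, ← qh_sq]
    field_simp
    ring

theorem transpose_mem : ∀ f ∈ DU q, transpose f ∈ DU q := by
  rintro f ⟨N, hsL, hzR⟩
  have hsL' : Function.Semiconj transpose (zR q) (sL q) := fun f => (sL_transpose f).symm
  have hzR' : Function.Semiconj transpose (sL q) (zR q) := fun f => (zR_transpose f).symm
  refine ⟨N, ?_, ?_⟩
  · rw [Module.End.pow_apply, ← hsL'.iterate_right, ← Module.End.pow_apply, hzR, map_zero]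
  · rw [Module.End.pow_apply, ← hzR'.iterate_right, ← Module.End.pow_apply, hsL, map_zero]

/-- The transposition of finite functions. -/
def transposeDU (q : Set.Ioo (0 : ℝ) 1) : Module.End ℂ (DU q) :=
  transpose.restrict transpose_mem

/-! ### Vacuum projection and matrix units -/

theorem one_sub_pow_ne (q : Set.Ioo (0 : ℝ) 1) (n : ℕ) : 1 - qc q ^ (2 * (n + 1)) ≠ 0 :=
  sub_ne_zero.2 (qc_pow_ne_one q (by omega)).symm

/-- The vacuum projection `f₀`, the function of `y` supported at `y = 1`. -/
def vac (q : Set.Ioo (0 : ℝ) 1) : Series := funY q (Pi.single 0 1)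

theorem vac_zero_zero : vac q 0 0 = 1 := by
  simpa [vac, funY, zzVal] using yCoeff_spec q (Pi.single 0 1) 0

theorem sL_vac : sL q (vac q) = 0 := by
  have h : (fun n => (Pi.single 0 1 : ℕ → ℂ) (n + 1)) = 0 := by ext n; simp
  rw [vac, sL_funY, h, ← funYₗ_apply, map_zero, map_zero]

theorem transpose_vac : transpose (vac q) = vac q := transpose_funY _

theorem zR_vac : zR q (vac q) = 0 := by
  rw [← transpose_vac, zR_transpose, sL_vac, map_zero]

theorem eq_zero_of_sL_eq_zero_of_zR_eq_zero {g : Series} (hs : sL q g = 0) (hz : zR q g = 0)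
    (h0 : g 0 0 = 0) : g = 0 := by
  ext j k
  induction j generalizing k with
  | zero =>
    cases k with
    | zero => exact h0
    | succ k => simpa [zR, one_sub_pow_ne q k] using congrFun₂ hz 0 k
  | succ j ih =>
    have hup : upS g j k = 0 := by
      cases k with
      | zero => exact upS_zero g j
      | succ k => exact ih k
    simpa [sL, hup, one_sub_pow_ne q j] using congrFun₂ hs j k

theorem eq_smul_vac {g : Series} (hs : sL q g = 0) (hz : zR q g = 0) : g = g 0 0 • vac q := by
  refine sub_eq_zero.1 (eq_zero_of_sL_eq_zero_of_zR_eq_zero (q := q) ?_ ?_ ?_)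
  · rw [map_sub, map_smul, hs, sL_vac, smul_zero, sub_zero]
  · rw [map_sub, map_smul, hz, zR_vac, smul_zero, sub_zero]
  · simp [vac_zero_zero]

/-- The matrix units `z^m f₀ z^{*n}`, not normalized. -/
def matUnit (q : Set.Ioo (0 : ℝ) 1) (m n : ℕ) : Series := (sR ^ n) ((zL ^ m) (vac q))

theorem sR_zL (f : Series) : sR (zL f) = zL (sR f) := by
  ext j k
  cases j <;> cases k <;> simp [sR, zL]

theorem sL_sR (f : Series) : sL q (sR f) = sR (sL q f) := by
  ext j k
  rcases k with _ | _ | k <;> simp [sL, sR]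

theorem matUnit_zero_zero : matUnit q 0 0 = vac q := rfl

theorem sR_matUnit (m n : ℕ) : sR (matUnit q m n) = matUnit q m (n + 1) := by
  rw [matUnit, matUnit, pow_succ', Module.End.mul_apply]

theorem zL_matUnit (m n : ℕ) : zL (matUnit q m n) = matUnit q (m + 1) n := by
  induction n with
  | zero => rw [matUnit, matUnit, pow_zero, pow_succ' zL, Module.End.mul_apply]; rfl
  | succ n ih => rw [← sR_matUnit, ← sR_zL, ih, sR_matUnit]

@[elab_as_elim]
theorem matUnit_induction {p : ℕ → ℕ → Prop} (zero : p 0 0) (zL : ∀ m, p m 0 → p (m + 1) 0)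
    (sR : ∀ m n, p m n → p m (n + 1)) (m n : ℕ) : p m n :=
  n.rec (m.rec zero zL) (sR m)

theorem transpose_matUnit (m n : ℕ) : transpose (matUnit q m n) = matUnit q n m := by
  induction m, n using matUnit_induction with
  | zero => exact transpose_vac
  | zL m ih => rw [← zL_matUnit, ← sR_transpose, ih, sR_matUnit]
  | sR m n ih => rw [← sR_matUnit, ← zL_transpose, ih, zL_matUnit]

theorem sL_matUnit (m n : ℕ) :
    sL q (matUnit q m n) = (1 - qc q ^ (2 * m)) • matUnit q (m - 1) n := by
  induction m, n using matUnit_induction with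
  | zero => simp [matUnit_zero_zero, sL_vac]
  | zL m ih =>
    rw [← zL_matUnit, sL_zL, ih]
    cases m with
    | zero => simp
    | succ m =>
      rw [map_smul, zL_matUnit, Nat.add_sub_cancel, Nat.add_sub_cancel]
      module
  | sR m n ih => rw [← sR_matUnit, sL_sR, ih, map_smul, sR_matUnit]

theorem zR_matUnit (m n : ℕ) :
    zR q (matUnit q m n) = (1 - qc q ^ (2 * n)) • matUnit q m (n - 1) := by
  rw [← transpose_matUnit, zR_transpose, sL_matUnit, map_smul, transpose_matUnit]

theorem opK_sR (f : Series) : opK q (sR f) = (qc q ^ 2)⁻¹ • sR (opK q f) := by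
  have := qc_ne q
  ext j k
  cases k with
  | zero => simp [opK, sR]
  | succ k =>
    simp only [opK, sR, LinearMap.coe_mk, AddHom.coe_mk, Pi.smul_apply, smul_eq_mul, upS_succ,
      inv_pow]
    field_simp
    ring

theorem opK_matUnit (m n : ℕ) :
    opK q (matUnit q m n) = (qc q ^ (2 * m) * (qc q)⁻¹ ^ (2 * n)) • matUnit q m n := by
  induction m, n using matUnit_induction with
  | zero => simp only [matUnit_zero_zero, vac, opK_funY, mul_zero, pow_zero, mul_one, one_smul]
  | zL m ih =>
    rw [← zL_matUnit, opK_zL, ih, map_smul]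
    module
  | sR m n ih =>
    rw [← sR_matUnit, opK_sR, ih, map_smul, mul_add, pow_add _ (2 * n), inv_pow _ (2 * 1)]
    module

theorem opKinv_opK (f : Series) : opKinv q (opK q f) = f := by
  have := qc_ne q
  ext j k
  simp only [opKinv, opK, LinearMap.coe_mk, AddHom.coe_mk, inv_pow]
  field_simp

theorem opKinv_matUnit (m n : ℕ) :
    opKinv q (matUnit q m n) = ((qc q)⁻¹ ^ (2 * m) * qc q ^ (2 * n)) • matUnit q m n := by
  have hq := qc_ne q
  have h : (qc q)⁻¹ ^ (2 * m) * qc q ^ (2 * n) * (qc q ^ (2 * m) * (qc q)⁻¹ ^ (2 * n)) = 1 := by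
    rw [inv_pow, inv_pow]
    field_simp
  rw [← opKinv_opK (_ • matUnit q m n), map_smul (opK q), opK_matUnit, smul_smul, h, one_smul]

theorem opE_sR (f : Series) : opE q (sR f) = sR (opE q f) + (qh q ^ 3)⁻¹ • opK q f := by
  ext j k
  rcases j with _ | j <;> rcases k with _ | k <;>
    simp only [opE, opK, sR, LinearMap.coe_mk, AddHom.coe_mk, Pi.add_apply, Pi.smul_apply,
      smul_eq_mul, upS_zero, upS_succ, upZ_zero, upZ_succ, brk, Finset.range_zero,
      Finset.sum_empty, Finset.sum_range_succ, inv_pow, ← pow_mul] <;>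
    ring

theorem opE_vac : opE q (vac q) = -(qh q / (1 - qc q ^ 2)) • matUnit q 1 0 := by
  have hsL : sL q (opE q (vac q)) = -qh q • vac q := by
    have h := opE_sL q (vac q)
    have h1 := qh_ne q
    rw [sL_vac, map_zero, eq_comm, add_eq_zero_iff_eq_neg',
      inv_smul_eq_iff₀ (pow_ne_zero 2 (qc_ne q))] at h
    rw [h, smul_neg, smul_smul, neg_smul, ← qh_sq]
    congr 2
    field_simp
  have hzR : zR q (opE q (vac q)) = 0 := by
    have h := opE_zR q (vac q)
    rwa [vac, opK_funY, ← vac, zR_vac, map_zero, map_zero, smul_zero, sub_zero, eq_comm] at h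
  rw [neg_smul, ← add_eq_zero_iff_eq_neg]
  refine eq_zero_of_sL_eq_zero_of_zR_eq_zero (q := q) ?_ ?_ ?_
  · rw [map_add, map_smul, hsL, sL_matUnit, smul_smul, mul_one, div_mul_cancel₀ _ (one_sub_ne q),
      neg_smul]
    exact neg_add_cancel _
  · simp [hzR, zR_matUnit]
  · simp [← zL_matUnit, opE, zL, vac, funY]

theorem opE_matUnit (m n : ℕ) :
    opE q (matUnit q m n) = -(qh q / (1 - qc q ^ 2)) • matUnit q (m + 1) n +
      ((qh q ^ 3)⁻¹ * qc q ^ (2 * m) * brk ((qc q)⁻¹ ^ 2) n) • matUnit q m (n - 1) := by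
  have h := one_sub_ne q
  induction m, n using matUnit_induction with
  | zero => simp [matUnit_zero_zero, opE_vac]
  | zL m ih =>
    rw [← zL_matUnit, opE_zL, ih]
    simp only [brk_zero, mul_zero, zero_smul, add_zero, map_smul, zL_matUnit, smul_smul,
      ← add_smul]
    congr 1
    field_simp
    ring
  | sR m n ih =>
    rw [← sR_matUnit, opE_sR, ih, opK_matUnit, map_add, map_smul, map_smul, sR_matUnit, add_assoc]
    congr 1
    cases n with
    | zero => simp [brk, smul_smul]
    | succ n =>
      rw [sR_matUnit, Nat.add_sub_cancel, Nat.add_sub_cancel, smul_smul, ← add_smul, brk, brk,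
        Finset.sum_range_succ _ (n + 1), ← pow_mul]
      congr 1
      ring

/-! ### The matrix units span the finite functions -/

theorem matUnit_mem (m n : ℕ) : matUnit q m n ∈ DU q := by
  have hsL (m n : ℕ) : matUnit q m n ∈ nilSub (sL q) := by
    induction m with
    | zero => exact ⟨1, by simp [sL_matUnit]⟩
    | succ m ih => exact nilSub_apply_iff.1 (sL_matUnit (q := q) _ n ▸ Submodule.smul_mem _ _ ih)
  have hzR : matUnit q m n ∈ nilSub (zR q) := by
    induction n with
    | zero => exact ⟨1, by simp [zR_matUnit]⟩
    | succ n ih => exact nilSub_apply_iff.1 (zR_matUnit (q := q) m _ ▸ Submodule.smul_mem _ _ ih)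
  exact mem_DU.2 ⟨hsL m n, hzR⟩

theorem ker_sL_inf_nilSub_le_span :
    LinearMap.ker (sL q) ⊓ nilSub (zR q) ≤ Submodule.span ℂ (Set.range (matUnit q 0)) := by
  rintro f ⟨hsL, N, hN⟩
  refine mem_of_pow_apply_eq_zero (P := LinearMap.ker (sL q)) (fun f hf => ?_) ?_ ?_ hsL hN
  · rw [LinearMap.mem_ker, ← zR_sL, LinearMap.mem_ker.1 hf, map_zero]
  · rintro g ⟨hs, hz⟩
    rw [eq_smul_vac hs hz]
    exact Submodule.smul_mem _ _ (Submodule.subset_span ⟨0, rfl⟩)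
  · rw [Submodule.span_le]
    rintro _ ⟨n, rfl⟩
    refine ⟨(1 - qc q ^ (2 * (n + 1)))⁻¹ • matUnit q 0 (n + 1), ⟨Submodule.smul_mem _ _
      (Submodule.subset_span ⟨n + 1, rfl⟩), by simp [sL_matUnit]⟩, ?_⟩
    rw [map_smul, zR_matUnit, inv_smul_smul₀ (one_sub_pow_ne q n), Nat.add_sub_cancel]

theorem DU_le_span_matUnit :
    DU q ≤ Submodule.span ℂ (Set.range fun p : ℕ × ℕ => matUnit q p.1 p.2) := by
  intro f hf
  obtain ⟨⟨N, hN⟩, hzR⟩ := mem_DU.1 hf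
  refine mem_of_pow_apply_eq_zero (P := nilSub (zR q)) (fun f => ?_) ?_ ?_ hzR hN
  · exact nilSub_map 1 0 (fun f => by rw [zR_sL, one_smul]; exact (add_zero _).symm)
      (fun _ _ => zero_mem _) f
  · rw [inf_comm]
    refine ker_sL_inf_nilSub_le_span.trans (Submodule.span_mono ?_)
    rintro _ ⟨n, rfl⟩
    exact ⟨(0, n), rfl⟩
  · rw [Submodule.span_le]
    rintro _ ⟨⟨m, n⟩, rfl⟩
    refine ⟨(1 - qc q ^ (2 * (m + 1)))⁻¹ • matUnit q (m + 1) n, ⟨Submodule.smul_mem _ _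
      (Submodule.subset_span ⟨(m + 1, n), rfl⟩), Submodule.smul_mem _ _
      (mem_DU.1 (matUnit_mem _ _)).2⟩, ?_⟩
    rw [map_smul, sL_matUnit, inv_smul_smul₀ (one_sub_pow_ne q m), Nat.add_sub_cancel]

/-- The matrix units as elements of `D(U)_q`. -/
def unitDU (q : Set.Ioo (0 : ℝ) 1) (m n : ℕ) : DU q := ⟨matUnit q m n, matUnit_mem m n⟩

theorem span_range_unitDU : Submodule.span ℂ (Set.range fun p : ℕ × ℕ => unitDU q p.1 p.2) = ⊤ := by
  rw [← top_le_iff, ← Submodule.map_le_map_iff_of_injective (DU q).injective_subtype,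
    Submodule.map_span, ← Set.range_comp, Submodule.map_subtype_top]
  exact DU_le_span_matUnit

theorem unitDU_linearMap_ext {M : Type*} [AddCommGroup M] [Module ℂ M] {φ ψ : DU q →ₗ[ℂ] M}
    (h : ∀ m n, φ (unitDU q m n) = ψ (unitDU q m n)) : φ = ψ :=
  LinearMap.ext_on_range span_range_unitDU fun p => h p.1 p.2

/-! ### The trace of a matrix unit -/

/-- The `q²`-Pochhammer symbol `(q²; q²)_n`. -/
def qPochhammer (q : Set.Ioo (0 : ℝ) 1) (n : ℕ) : ℂ :=
  ∏ i ∈ Finset.range n, (1 - qc q ^ (2 * (i + 1)))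

theorem qPochhammer_zero : qPochhammer q 0 = 1 := Finset.prod_range_zero _

theorem qPochhammer_succ (n : ℕ) :
    qPochhammer q (n + 1) = qPochhammer q n * (1 - qc q ^ (2 * (n + 1))) :=
  Finset.prod_range_succ _ _

theorem mulS_zero_left (g : Series) : mulS q 0 g = 0 := by
  have h (k : ℕ) : cv (fun j => (0 : Series) j k) ((sL q ^ k) g) = 0 := cv_zero _
  rw [mulS, finsum_congr h, finsum_zero]

section Product

variable {g : Series} (hg : g ∈ nilSub (sL q))
include hg

theorem mulS_add_left (f f' : Series) : mulS q (f + f') g = mulS q f g + mulS q f' g := by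
  obtain ⟨N, hN⟩ := hg
  rw [mulS_eq q f g hN, mulS_eq q f' g hN, mulS_eq q _ g hN, ← Finset.sum_add_distrib]
  exact Finset.sum_congr rfl fun k _ => cv_add _ _ _

theorem mulS_smul_left (c : ℂ) (f : Series) : mulS q (c • f) g = c • mulS q f g := by
  obtain ⟨N, hN⟩ := hg
  rw [mulS_eq q f g hN, mulS_eq q _ g hN, Finset.smul_sum]
  refine Finset.sum_congr rfl fun k _ => ?_
  ext m n
  simp [cv, Finset.mul_sum, mul_assoc]

theorem mulS_zL (f : Series) : mulS q (zL f) g = zL (mulS q f g) := by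
  have hcv (k : ℕ) (g : Series) : cv (fun j => zL f j k) g = zL (cv (fun j => f j k) g) := by
    ext m n
    cases m with
    | zero => simp [cv, zL]
    | succ m => simp [cv, zL, Finset.Nat.sum_antidiagonal_succ]
  obtain ⟨N, hN⟩ := hg
  rw [mulS_eq q f g hN, mulS_eq q _ g hN, map_sum]
  exact Finset.sum_congr rfl fun k _ => hcv k _

theorem mulS_sR (f : Series) : mulS q (sR f) g = mulS q f (sL q g) := by
  obtain ⟨N, hN⟩ := hg
  have hN1 : (sL q ^ (N + 1)) g = 0 := pow_zero_of_le (Nat.le_succ N) hN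
  have hN' : (sL q ^ N) (sL q g) = 0 := by rwa [← Module.End.mul_apply, ← pow_succ]
  have h0 : (fun j => sR f j 0) = 0 := by ext j; simp [sR]
  rw [mulS_eq q f _ hN', mulS_eq q _ g hN1, Finset.sum_range_succ', h0, cv_zero, add_zero]
  refine Finset.sum_congr rfl fun k _ => ?_
  simp only [pow_succ, Module.End.mul_apply, sR, LinearMap.coe_mk, AddHom.coe_mk, upS_succ]

theorem mulS_vac_zero_zero : mulS q (vac q) g 0 0 = g 0 0 := by
  obtain ⟨N, hN⟩ := hg
  rw [mulS_eq q _ g (pow_zero_of_le (Nat.le_succ N) hN), Finset.sum_apply, Finset.sum_apply,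
    Finset.sum_range_succ']
  simp [cv, vac_zero_zero, show ∀ k, vac q 0 (k + 1) = 0 from fun _ => rfl]

theorem mulS_vac (h : zR q g = 0) : mulS q (vac q) g = g 0 0 • vac q := by
  rw [← mulS_vac_zero_zero hg]
  refine eq_smul_vac ?_ ?_
  · rw [sL_mulS q _ hg, sL_vac, mulS_zero_left]
  · rw [zR_mulS q _ hg, h]
    simp [mulS]

theorem mulS_matUnit (h : zR q g = 0) (m n : ℕ) :
    mulS q (matUnit q m n) g = ((sL q ^ n) g) 0 0 • matUnit q m 0 := by
  induction m, n using matUnit_induction generalizing g with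
  | zero => exact mulS_vac hg h
  | zL m ih => rw [← zL_matUnit, mulS_zL hg, ih hg h, map_smul, zL_matUnit]
  | sR m n ih =>
    rw [← sR_matUnit, mulS_sR hg, ih (nilSub_apply_iff.2 hg) (by rw [zR_sL, h, map_zero]),
      pow_succ, Module.End.mul_apply]

end Product

theorem sL_pow_matUnit_zero_zero (m n : ℕ) :
    ((sL q ^ n) (matUnit q m 0)) 0 0 = if m = n then qPochhammer q n else 0 := by
  induction n generalizing m with
  | zero =>
    cases m with
    | zero => simp [matUnit_zero_zero, vac_zero_zero, qPochhammer_zero]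
    | succ m => simp [← zL_matUnit, zL]
  | succ n ih =>
    rw [pow_succ, Module.End.mul_apply, sL_matUnit, map_smul]
    cases m with
    | zero => simp
    | succ m =>
      by_cases h : m = n
      · simp [ih, h, qPochhammer_succ, mul_comm]
      · simp [ih, h]

/-- The basis vectors `z^m f₀` of `H̃`. -/
def vecH (q : Set.Ioo (0 : ℝ) 1) (m : ℕ) : Htilde q :=
  ⟨matUnit q m 0, matUnit_mem m 0, (zR_matUnit m 0).trans (by simp)⟩

/-- The linear map `f ↦ T̃(f) Γ̃(K⁻¹)`, whose trace is `η`. -/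
def traceOp (q : Set.Ioo (0 : ℝ) 1) : DU q →ₗ[ℂ] Module.End ℂ (Htilde q) where
  toFun f := Ttilde q f * Gtilde q (KinvB q)
  map_add' f g := LinearMap.ext fun h => Subtype.ext <|
    mulS_add_left (mem_DU.1 (Gtilde q (KinvB q) h).2.1).1 f.1 g.1
  map_smul' c f := LinearMap.ext fun h => Subtype.ext <|
    mulS_smul_left (mem_DU.1 (Gtilde q (KinvB q) h).2.1).1 c f.1

theorem Gtilde_Kinv_apply (h : Htilde q) : (Gtilde q (KinvB q) h : Series) = opKinv q h := by
  change (actDU q (gen q UqGen.Kinv) (inclH q h) : Series) = _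
  rw [actDU_gen]
  rfl

/-- The constant term of `z^{*n} K⁻¹h`, the functional through which a matrix unit acts on `H̃`. -/
def coordH (q : Set.Ioo (0 : ℝ) 1) (n : ℕ) : Htilde q →ₗ[ℂ] ℂ :=
  LinearMap.proj 0 ∘ₗ LinearMap.proj 0 ∘ₗ (sL q ^ n) ∘ₗ opKinv q ∘ₗ (Htilde q).subtype

theorem traceOp_unitDU (m n : ℕ) : traceOp q (unitDU q m n) = (coordH q n).smulRight (vecH q m) :=
  LinearMap.ext fun h => by
    have hK := (Gtilde q (KinvB q) h).2
    refine Subtype.ext ((mulS_matUnit (mem_DU.1 hK.1).1 hK.2 m n).trans ?_)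
    rw [Gtilde_Kinv_apply]
    rfl

theorem coordH_vecH (m n : ℕ) :
    coordH q n (vecH q m) = if m = n then qPochhammer q m * (qc q)⁻¹ ^ (2 * m) else 0 := by
  change ((sL q ^ n) (opKinv q (matUnit q m 0))) 0 0 = _
  rw [opKinv_matUnit, map_smul, Pi.smul_apply, Pi.smul_apply, sL_pow_matUnit_zero_zero]
  by_cases h : m = n
  · simp [h, mul_comm]
  · simp [h]

theorem traceOp_mem_finiteRank (f : DU q) : traceOp q f ∈ finiteRank ℂ (Htilde q) := by
  suffices h : ⊤ ≤ (finiteRank ℂ (Htilde q)).comap (traceOp q) from h Submodule.mem_top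
  rw [← span_range_unitDU, Submodule.span_le]
  rintro _ ⟨⟨m, n⟩, rfl⟩
  change traceOp q (unitDU q m n) ∈ finiteRank ℂ _
  rw [traceOp_unitDU]
  exact smulRight_mem_finiteRank _ _

/-- `η` as a linear functional. -/
def etaₗ (q : Set.Ioo (0 : ℝ) 1) : DU q →ₗ[ℂ] ℂ :=
  finTraceₗ _ ∘ₗ (traceOp q).codRestrict (finiteRank ℂ _) traceOp_mem_finiteRank

theorem etaₗ_apply (f : DU q) : etaₗ q f = eta q f := rfl

theorem eta_unitDU (m n : ℕ) :
    eta q (unitDU q m n) = if m = n then qPochhammer q m * (qc q)⁻¹ ^ (2 * m) else 0 := by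
  rw [← coordH_vecH, ← finTrace_smulRight, ← traceOp_unitDU]
  rfl

/-! ### Invariance of the trace -/

theorem genDU_K_unitDU (m n : ℕ) : genDU q UqGen.K (unitDU q m n) =
    (qc q ^ (2 * m) * (qc q)⁻¹ ^ (2 * n)) • unitDU q m n :=
  Subtype.ext (opK_matUnit m n)

theorem genDU_E_unitDU (m n : ℕ) : genDU q UqGen.E (unitDU q m n) =
    -(qh q / (1 - qc q ^ 2)) • unitDU q (m + 1) n +
      ((qh q ^ 3)⁻¹ * qc q ^ (2 * m) * brk ((qc q)⁻¹ ^ 2) n) • unitDU q m (n - 1) :=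
  Subtype.ext (opE_matUnit m n)

theorem genDU_F_transposeDU (f : DU q) : genDU q UqGen.F (transposeDU q f) =
    qc q ^ 2 • transposeDU q (genDU q UqGen.E f) :=
  Subtype.ext (opF_transpose f.1)

theorem transposeDU_transposeDU (f : DU q) : transposeDU q (transposeDU q f) = f := rfl

theorem etaₗ_comp_genDU_K : etaₗ q ∘ₗ genDU q UqGen.K = etaₗ q := by
  refine unitDU_linearMap_ext fun m n => ?_
  rw [LinearMap.comp_apply, genDU_K_unitDU, map_smul, etaₗ_apply, eta_unitDU]
  by_cases h : m = n
  · simp [h, qc_ne q]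
  · simp [h]

theorem etaₗ_comp_genDU_E : etaₗ q ∘ₗ genDU q UqGen.E = 0 := by
  refine unitDU_linearMap_ext fun m n => ?_
  rw [LinearMap.comp_apply, genDU_E_unitDU, map_add, map_smul, map_smul, etaₗ_apply, etaₗ_apply,
    eta_unitDU, eta_unitDU]
  rcases n with _ | n
  · simp
  by_cases hmn : m = n
  · have h := one_sub_ne q
    have h1 := qh_ne q
    have h3 : qc q ^ 2 = qh q ^ 4 := by rw [← qh_sq]; ring
    subst hmn
    rw [if_pos rfl, Nat.add_sub_cancel, if_pos rfl, brk_neg, qPochhammer_succ, inv_pow, inv_pow]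
    simp only [LinearMap.zero_apply, smul_eq_mul, mul_add, pow_add, mul_one, pow_mul, h3] at h ⊢
    field_simp
    ring
  · simp [hmn]

theorem etaₗ_comp_transposeDU : etaₗ q ∘ₗ transposeDU q = etaₗ q := by
  refine unitDU_linearMap_ext fun m n => ?_
  have h : transposeDU q (unitDU q m n) = unitDU q n m := Subtype.ext (transpose_matUnit m n)
  rw [LinearMap.comp_apply, h, etaₗ_apply, etaₗ_apply, eta_unitDU, eta_unitDU]
  by_cases hmn : m = n
  · rw [hmn]
  · rw [if_neg hmn, if_neg (Ne.symm hmn)]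

theorem isInvariantIntegral_eta : IsInvariantIntegral (actDU q) (eta q) := by
  have hK (f : DU q) : etaₗ q (genDU q UqGen.K f) = etaₗ q f :=
    LinearMap.congr_fun etaₗ_comp_genDU_K f
  have hE (f : DU q) : etaₗ q (genDU q UqGen.E f) = 0 := LinearMap.congr_fun etaₗ_comp_genDU_E f
  have htr (f : DU q) : etaₗ q (transposeDU q f) = etaₗ q f :=
    LinearMap.congr_fun etaₗ_comp_transposeDU f
  refine isInvariantIntegral_of_gen (etaₗ q) (fun f => ?_) (fun f => ?_) fun f => ?_
  · rw [actDU_gen, hK]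
  · rw [actDU_gen, hE]
  · rw [actDU_gen, ← transposeDU_transposeDU f, genDU_F_transposeDU, map_smul, htr, hE, smul_zero]

/-! ### The decomposition of finite functions -/

/-- The component of weight `i` with coefficient function `ψ`, which is `z^i ψ(y)` for `i ≥ 0` and
`ψ(y) z^{*(-i)}` for `i ≤ 0`. At least one of the two truncated exponents vanishes. -/
def weightPart (q : Set.Ioo (0 : ℝ) 1) (i : ℤ) : (ℕ →₀ ℂ) →ₗ[ℂ] Series :=
  (zL ^ i.toNat) ∘ₗ (sR ^ (-i).toNat) ∘ₗ funYₗ q ∘ₗ Finsupp.lcoeFun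

theorem weightPart_eq (i : ℤ) (φ : ℕ →₀ ℂ) :
    weightPart q i φ = (zL ^ i.toNat) ((sR ^ (-i).toNat) (funY q φ)) := rfl

/-- `ofParts` as a linear map. -/
def ofPartsₗ (q : Set.Ioo (0 : ℝ) 1) : (ℤ →₀ ℕ →₀ ℂ) →ₗ[ℂ] Series :=
  Finsupp.lsum ℂ (weightPart q)

theorem ofPartsₗ_apply (ψ : ℤ →₀ ℕ →₀ ℂ) : ofPartsₗ q ψ = ofParts q ψ := by
  refine Finset.sum_congr rfl fun i _ => ?_
  change weightPart q i (ψ i) = _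
  rw [weightPart_eq]
  split_ifs with hi
  · simp [Int.toNat_of_nonpos (Int.neg_nonpos_of_nonneg hi)]
  · simp [Int.toNat_of_nonpos (not_le.1 hi).le]

theorem zL_pow_apply (f : Series) (i j k : ℕ) :
    (zL ^ i) f j k = if i ≤ j then f (j - i) k else 0 := by
  induction i generalizing j with
  | zero => simp
  | succ i ih =>
    rw [pow_succ', Module.End.mul_apply]
    cases j with
    | zero => simp [zL]
    | succ j =>
      simp only [Nat.add_le_add_iff_right, Nat.add_sub_add_right]
      exact ih j

theorem sR_pow_apply (f : Series) (i j k : ℕ) :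
    (sR ^ i) f j k = if i ≤ k then f j (k - i) else 0 := by
  induction i generalizing k with
  | zero => simp
  | succ i ih =>
    rw [pow_succ', Module.End.mul_apply]
    cases k with
    | zero => simp [sR]
    | succ k =>
      simp only [Nat.add_le_add_iff_right, Nat.add_sub_add_right]
      exact ih k

theorem weightPart_apply (i : ℤ) (φ : ℕ →₀ ℂ) (j k : ℕ) :
    weightPart q i φ j k = if i = (j : ℤ) - k then yCoeff q φ (min j k) else 0 := by
  rw [weightPart_eq, zL_pow_apply, sR_pow_apply, funY]
  grind

theorem ofParts_apply (ψ : ℤ →₀ ℕ →₀ ℂ) (j k : ℕ) :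
    ofParts q ψ j k = yCoeff q (ψ (j - k)) (min j k) := by
  have h : ofParts q ψ j k = ψ.sum fun i φ => weightPart q i φ j k := by
    rw [← ofPartsₗ_apply, ofPartsₗ, Finsupp.lsum_apply, Finsupp.sum, Finset.sum_apply,
      Finset.sum_apply, Finsupp.sum]
  rw [h, Finsupp.sum_eq_single ((j : ℤ) - k) (fun i _ hi => by rw [weightPart_apply, if_neg hi])
    (fun _ => by rw [map_zero]; rfl), weightPart_apply, if_pos rfl]

theorem ofParts_injective : Function.Injective (ofParts q) := by
  intro ψ ψ' h
  ext i n
  refine congrFun (yCoeff_injective (q := q) (funext fun k => ?_)) n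
  have hk := congrFun₂ h (i.toNat + k) ((-i).toNat + k)
  rwa [ofParts_apply, ofParts_apply, show min (i.toNat + k) ((-i).toNat + k) = k by omega,
    show ((i.toNat + k : ℕ) : ℤ) - ((-i).toNat + k : ℕ) = i by omega] at hk

theorem zL_pow_matUnit (i m n : ℕ) : (zL ^ i) (matUnit q m n) = matUnit q (i + m) n := by
  induction i with
  | zero => simp
  | succ i ih => rw [pow_succ', Module.End.mul_apply, ih, zL_matUnit, add_right_comm]

theorem sR_pow_matUnit (i m n : ℕ) : (sR ^ i) (matUnit q m n) = matUnit q m (i + n) := by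
  induction i with
  | zero => simp
  | succ i ih => rw [pow_succ', Module.End.mul_apply, ih, sR_matUnit, add_right_comm]

theorem matUnit_self (m : ℕ) : matUnit q m m = funY q (Pi.single m (qPochhammer q m)) := by
  induction m with
  | zero => rw [qPochhammer_zero]; rfl
  | succ m ih =>
    rw [← zL_matUnit, ← sR_matUnit, ih, zL_sR_funY]
    congr 1
    funext n
    cases n with
    | zero => simp
    | succ n =>
      by_cases h : n = m
      · simp [h, qPochhammer_succ, mul_comm]
      · simp [h]

theorem matUnit_eq_ofParts (m n : ℕ) : matUnit q m n = ofParts q (Finsupp.single ((m : ℤ) - n)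
    (Finsupp.single (min m n) (qPochhammer q (min m n)))) := by
  rw [← ofPartsₗ_apply, ofPartsₗ, Finsupp.lsum_single, weightPart_eq, Finsupp.single_eq_pi_single,
    ← matUnit_self, sR_pow_matUnit, zL_pow_matUnit]
  congr 1 <;> omega

theorem exists_eq_ofParts (f : DU q) : ∃ ψ, (f : Series) = ofParts q ψ := by
  suffices h : DU q ≤ LinearMap.range (ofPartsₗ q) by
    obtain ⟨ψ, hψ⟩ := h f.2
    exact ⟨ψ, hψ.symm.trans (ofPartsₗ_apply ψ)⟩
  refine DU_le_span_matUnit.trans (Submodule.span_le.2 ?_)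
  rintro _ ⟨⟨m, n⟩, rfl⟩
  exact ⟨_, (ofPartsₗ_apply _).trans (matUnit_eq_ofParts m n).symm⟩

theorem ofParts_parts (f : DU q) : ofParts q (parts q f) = f := by
  have h := exists_eq_ofParts f
  rw [parts, dif_pos h]
  exact h.choose_spec.symm

/-- `parts` as a linear map. -/
def partsₗ (q : Set.Ioo (0 : ℝ) 1) : DU q →ₗ[ℂ] ℤ →₀ ℕ →₀ ℂ where
  toFun f := parts q f
  map_add' f g := ofParts_injective (q := q) <| by
    rw [ofParts_parts, ← ofPartsₗ_apply, map_add, ofPartsₗ_apply, ofPartsₗ_apply, ofParts_parts,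
      ofParts_parts]
    rfl
  map_smul' c f := ofParts_injective (q := q) <| by
    rw [ofParts_parts, ← ofPartsₗ_apply, map_smul, ofPartsₗ_apply, ofParts_parts]
    rfl

theorem parts_unitDU (m n : ℕ) : parts q (unitDU q m n) =
    Finsupp.single ((m : ℤ) - n) (Finsupp.single (min m n) (qPochhammer q (min m n))) :=
  ofParts_injective <| (ofParts_parts _).trans (matUnit_eq_ofParts m n)

/-! ### The integral over the quantum disc -/

/-- The integral over the quantum disc as a linear functional. -/
def nuIntegralₗ (q : Set.Ioo (0 : ℝ) 1) : DU q →ₗ[ℂ] ℂ :=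
  (1 - qc q ^ 2) • (Finsupp.lsum ℂ fun n => LinearMap.mulRight ℂ ((qc q)⁻¹ ^ (2 * n))) ∘ₗ
    Finsupp.lapply 0 ∘ₗ partsₗ q

theorem nuIntegral_unitDU (m n : ℕ) :
    nuIntegral q (unitDU q m n) = (1 - qc q ^ 2) * eta q (unitDU q m n) := by
  rw [nuIntegral, parts_unitDU, eta_unitDU]
  by_cases h : m = n
  · simp [h]
  · rw [Finsupp.single_eq_of_ne (by omega), if_neg h, Finsupp.sum_zero_index]

theorem nuIntegral_eq (f : DU q) : nuIntegral q f = (1 - qc q ^ 2) * eta q f := by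
  have h : nuIntegralₗ q = (1 - qc q ^ 2) • etaₗ q := unitDU_linearMap_ext nuIntegral_unitDU
  exact LinearMap.congr_fun h f

theorem isInvariantIntegral_nuIntegral : IsInvariantIntegral (actDU q) (nuIntegral q) := by
  rw [funext nuIntegral_eq]
  exact isInvariantIntegral_eta.const_mul _

end QDisc

end

theorem theorem3p5 (q : Set.Ioo (0 : ℝ) 1) :
    -- the trace is that of operators of finite rank, and `η` is an invariant integral
    (∀ f : DU q, FiniteDimensional ℂ (LinearMap.range (Ttilde q f * Gtilde q (KinvB q)))) ∧
    IsInvariantIntegral (actDU q) (eta q) ∧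
    -- the decomposition that defines `∫ f dν` exists and is unique
    (∀ f : DU q, ∃! ψ : ℤ →₀ ℕ →₀ ℂ, (f : Series) = ofParts q ψ) ∧
    -- `∫ f dν` is a nonzero multiple of `η`, and an invariant integral
    (∃ c : ℂ, c ≠ 0 ∧ ∀ f : DU q, nuIntegral q f = c * eta q f) ∧
    IsInvariantIntegral (actDU q) (nuIntegral q) := by
  refine ⟨traceOp_mem_finiteRank, isInvariantIntegral_eta, fun f => ?_,
    ⟨1 - qc q ^ 2, one_sub_ne q, nuIntegral_eq⟩, isInvariantIntegral_nuIntegral⟩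
  obtain ⟨ψ, hψ⟩ := exists_eq_ofParts f
  exact ⟨ψ, hψ, fun ψ' hψ' => ofParts_injective (hψ'.symm.trans hψ)⟩
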